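/- **Lemma.** There is a static external-memory data structure for $n$ non-intersecting segments in the plane that uses $O(n\log_B n)$ words of disk space and answers vertical ray shooting and point location queries in $O(\log_B n)$ I/Os, where $B$ is the block size; here $\log_B n$ stands for $1+\log_B n$ when $n<B$. In detail. Segments are non-intersecting if two different ones have no common point, except possibly a common endpoint of both. A vertical ray shooting query at $q\in\mathbb R^2$ asks for a successor segment of $q$, that is, a segment first hit by the closed ray from $q$ in the $+y$-direction (or the answer that no segment is hit); a point location query, at a point $q$ that lies on no segment, asks for the identifier of the face containing $q$, the faces being the connected components of the complement of the union of the segments, with different faces having different identifiers. There are one query program and one constant $c$ such that for all integers $n\ge 0$, $B\ge 2$, $M\ge 2B$ and all families $S$ of $n$ non-intersecting segments (vertical segments allowed) there is a disk content of at most $c\,n\,(1+\log_B n)$ words (read as $0$ words for $n=0$) for which the program, given an arbitrary query point $q$, terminates after at most $c\,(1+\log_B n)$ I/Os (read as $c$ I/Os for $n=0$) with a successor segment of $q$ and, if $q$ is on no segment, with the identifier of the face containing $q$. The model is the standard external memory model: one I/O transfers a block of $B$ consecutive words from disk to the internal memory of $M$ words; the program performs arithmetic and comparisons on words in the internal memory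 and in a fixed number of registers only, and only I/Os are counted. A word holds a real number or an integer of absolute value at most $(n+B+2)^c$; real numbers admit exact $+,-,\times,/$ and comparisons but no rounding; the real numbers stored on disk are coordinates of endpoints of segments of $S$. Queries do not modify the disk. -/

import Mathlib

namespace ExtMem

/-! ### Segments, vertical ray shooting, faces -/

/-- Points of the plane. -/
abbrev Point : Type := ℝ × ℝ

/-- A closed line segment of the plane, given by its two endpoints. -/
structure Seg where
  p : Point
  q : Point

/-- The set of points of a segment. -/
def Seg.carrier (s : Seg) : Set Point := segment ℝ s.p s.q

/-- `z` is an endpoint of the segment `s`. -/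
def Seg.IsEndpoint (s : Seg) (z : Point) : Prop := z = s.p ∨ z = s.q

/-- Non-intersecting segments: two different segments have no point in common, except possibly
a common endpoint (as for the edges of a polygonal subdivision). -/
def NonIntersecting {n : ℕ} (S : Fin n → Seg) : Prop :=
  ∀ i j, i ≠ j → ∀ z, z ∈ (S i).carrier → z ∈ (S j).carrier →
    (S i).IsEndpoint z ∧ (S j).IsEndpoint z

/-- The vertical ray from `q` in the `+y`-direction hits segment `i` at height `y`. -/
def HitsAt {n : ℕ} (S : Fin n → Seg) (q : Point) (i : Fin n) (y : ℝ) : Prop :=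
  q.2 ≤ y ∧ (q.1, y) ∈ (S i).carrier

/-- Segment `i` is a successor segment of `q`: the upward vertical ray from `q` hits it, and hits
no segment at a lower height. -/
def IsSuccessor {n : ℕ} (S : Fin n → Seg) (q : Point) (i : Fin n) : Prop :=
  ∃ y, HitsAt S q i y ∧ ∀ j y', HitsAt S q j y' → y ≤ y'

/-- The complement of the union of all the segments. -/
def freeSpace {n : ℕ} (S : Fin n → Seg) : Set Point := (⋃ i, (S i).carrier)ᶜ

/-- The face of the subdivision induced by `S` that contains `q`. -/
def faceOf {n : ℕ} (S : Fin n → Seg) (q : Point) : Set Point :=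
  connectedComponentIn (freeSpace S) q

/-- The set of all faces of the subdivision induced by `S`. -/
def faces {n : ℕ} (S : Fin n → Seg) : Set (Set Point) := faceOf S '' freeSpace S

/-! ### The external memory model

A word holds a real number or an integer of absolute value at most `W`. The disk is divided into
blocks of `B` consecutive words. The internal memory has `M` words, next to the registers, of
which a program uses a fixed number. Programs compute on registers and internal memory only; the
cost of an execution is the number of blocks transferred from the disk. -/

/-- A machine word. -/
inductive Word where
  | real (x : ℝ)
  | int (k : ℤ)

/-- The integer `k` as a machine word, undefined in case of an overflow. -/
def Word.ofInt (W : ℕ) (k : ℤ) : Option Word := if |k| ≤ (W : ℤ) then some (.int k) else none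

/-- Arithmetic operations. -/
inductive BinOp where
  | add
  | sub
  | mul
  | div
  | mod

open Classical in
/-- The value of an arithmetic operation: exact arithmetic on two real numbers (there is no
rounding operation on real numbers), integer arithmetic on two integers, and undefined on
operands of different kinds, on overflow, and on division by zero. -/
noncomputable def BinOp.apply (W : ℕ) : BinOp → Word → Word → Option Word
  | .add, .int a, .int b => Word.ofInt W (a + b)
  | .sub, .int a, .int b => Word.ofInt W (a - b)
  | .mul, .int a, .int b => Word.ofInt W (a * b)
  | .div, .int a, .int b => if b = 0 then none else Word.ofInt W (a / b)
  | .mod, .int a, .int b => if b = 0 then none else Word.ofInt W (a % b)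
  | .add, .real x, .real y => some (.real (x + y))
  | .sub, .real x, .real y => some (.real (x - y))
  | .mul, .real x, .real y => some (.real (x * y))
  | .div, .real x, .real y => if y = 0 then none else some (.real (x / y))
  | _, _, _ => none

/-- The order of two words, as a proposition; undefined for words of different kinds. -/
def Word.ltProp : Word → Word → Option Prop
  | .int a, .int b => some (a < b)
  | .real x, .real y => some (x < y)
  | _, _ => none

/-- The contents of the registers and of the internal memory. -/
structure State where
  reg : ℕ → Word
  mem : ℕ → Word

/-- Expressions over registers and internal memory cells; the only constants are integers. -/
inductive Expr where
  | lit (k : ℤ)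
  | reg (i : ℕ)
  | mem (a : Expr)
  | op (o : BinOp) (a b : Expr)

/-- The value of an expression; undefined if an operation is undefined, or if an internal memory
address is not in the range `0, …, M - 1`. -/
noncomputable def Expr.eval (M W : ℕ) (s : State) : Expr → Option Word
  | .lit k => Word.ofInt W k
  | .reg i => some (s.reg i)
  | .mem a =>
    match a.eval M W s with
    | some (.int k) => if 0 ≤ k ∧ k < (M : ℤ) then some (s.mem k.toNat) else none
    | _ => none
  | .op o a b =>
    match a.eval M W s, b.eval M W s with
    | some u, some v => o.apply W u v
    | _, _ => none

/-- Programs. The tests of `ite a b c d` and `loop a b c` are both `a < b`. -/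
inductive Cmd where
  /-- do nothing -/
  | skip
  /-- register `i` receives the value of `e` -/
  | assign (i : ℕ) (e : Expr)
  /-- internal memory cell `a` receives the value of `e` -/
  | store (a e : Expr)
  /-- transfer block `blk` of the disk to the internal memory cells `dst, …, dst + B - 1` -/
  | read (blk dst : Expr)
  /-- first `c`, then `d` -/
  | seq (c d : Cmd)
  /-- if `a < b` then `c` else `d` -/
  | ite (a b : Expr) (c d : Cmd)
  /-- while `a < b` do `c` -/
  | loop (a b : Expr) (c : Cmd)

/-- The state after assigning `v` to register `i`. -/
def State.setReg (s : State) (i : ℕ) (v : Word) : State :=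
  { s with reg := Function.update s.reg i v }

/-- The state after writing `v` into the internal memory cell `a`. -/
def State.setMem (s : State) (a : ℕ) (v : Word) : State :=
  { s with mem := Function.update s.mem a v }

/-- The state after copying block `k` of the disk (words `k * B, …, k * B + B - 1`) to the
internal memory cells `d, …, d + B - 1`. Disk cells outside the stored list are blank. -/
def State.load (B : ℕ) (disk : List Word) (s : State) (k d : ℕ) : State :=
  { s with mem := fun a =>
      if d ≤ a ∧ a < d + B then disk.getD (k * B + (a - d)) (.int 0) else s.mem a }

/-- `Exec B M W disk c s t s'`: started in state `s`, the program `c` terminates in state `s'`,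
without meeting an undefined value, after exactly `t` block transfers. -/
inductive Exec (B M W : ℕ) (disk : List Word) : Cmd → State → ℕ → State → Prop
  | skip (s : State) : Exec B M W disk .skip s 0 s
  | assign (s : State) (i : ℕ) (e : Expr) (v : Word) (he : e.eval M W s = some v) :
      Exec B M W disk (.assign i e) s 0 (s.setReg i v)
  | store (s : State) (a e : Expr) (k : ℕ) (v : Word)
      (ha : a.eval M W s = some (.int k)) (hk : k < M) (he : e.eval M W s = some v) :
      Exec B M W disk (.store a e) s 0 (s.setMem k v)
  | read (s : State) (blk dst : Expr) (k d : ℕ)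
      (hb : blk.eval M W s = some (.int k)) (hd : dst.eval M W s = some (.int d))
      (hM : d + B ≤ M) :
      Exec B M W disk (.read blk dst) s 1 (s.load B disk k d)
  | seq (c d : Cmd) (s s' s'' : State) (t t' : ℕ)
      (hc : Exec B M W disk c s t s') (hd : Exec B M W disk d s' t' s'') :
      Exec B M W disk (.seq c d) s (t + t') s''
  | ite_true (a b : Expr) (c d : Cmd) (s s' : State) (t : ℕ) (u v : Word) (P : Prop)
      (ha : a.eval M W s = some u) (hb : b.eval M W s = some v)
      (hP : u.ltProp v = some P) (h : P) (hc : Exec B M W disk c s t s') :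
      Exec B M W disk (.ite a b c d) s t s'
  | ite_false (a b : Expr) (c d : Cmd) (s s' : State) (t : ℕ) (u v : Word) (P : Prop)
      (ha : a.eval M W s = some u) (hb : b.eval M W s = some v)
      (hP : u.ltProp v = some P) (h : ¬ P) (hd : Exec B M W disk d s t s') :
      Exec B M W disk (.ite a b c d) s t s'
  | loop_true (a b : Expr) (c : Cmd) (s s' s'' : State) (t t' : ℕ) (u v : Word) (P : Prop)
      (ha : a.eval M W s = some u) (hb : b.eval M W s = some v)
      (hP : u.ltProp v = some P) (h : P) (hc : Exec B M W disk c s t s')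
      (hl : Exec B M W disk (.loop a b c) s' t' s'') :
      Exec B M W disk (.loop a b c) s (t + t') s''
  | loop_false (a b : Expr) (c : Cmd) (s : State) (u v : Word) (P : Prop)
      (ha : a.eval M W s = some u) (hb : b.eval M W s = some v)
      (hP : u.ltProp v = some P) (h : ¬ P) :
      Exec B M W disk (.loop a b c) s 0 s

/-! ### Static structures and queries -/

/-- `x` is a coordinate of an endpoint of one of the segments. -/
def IsInputCoord {n : ℕ} (S : Fin n → Seg) (x : ℝ) : Prop :=
  ∃ i, x = (S i).p.1 ∨ x = (S i).p.2 ∨ x = (S i).q.1 ∨ x = (S i).q.2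

/-- The words that may be stored on disk for the input `S`: integers of absolute value at most
`W`, and real numbers that are coordinates of the input. (Arbitrary real numbers would allow the
whole input to be encoded in a single word.) -/
def StorableWord {n : ℕ} (S : Fin n → Seg) (W : ℕ) : Word → Prop
  | .int k => |k| ≤ (W : ℤ)
  | .real x => IsInputCoord S x

/-- The initial state for the query point `q`: registers `0` to `3` hold the two coordinates of
`q`, the block size, and the number of segments. -/
def queryState (B n : ℕ) (q : Point) : State where
  reg := fun i =>
    if i = 0 then .real q.1
    else if i = 1 then .real q.2
    else if i = 2 then .int B
    else if i = 3 then .int n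
    else .int 0
  mem := fun _ => .int 0

/-- The word `w` is a correct answer to the vertical ray shooting query `q`: it is `i + 1` for a
successor segment `i` of `q` (segments are numbered from `0`), and `0` if the ray hits nothing. -/
def IsRayShootingAnswer {n : ℕ} (S : Fin n → Seg) (q : Point) (w : Word) : Prop :=
  (∃ i : Fin n, w = .int ((i : ℤ) + 1) ∧ IsSuccessor S q i) ∨
    (w = .int 0 ∧ ∀ i y, ¬ HitsAt S q i y)

end ExtMem

namespace ExtMem

/-! ### Convexity of segments -/

/-! Non-intersecting segments can be listed from top to bottom, compatibly with the order on every
vertical line: insert the segment whose right end comes first into a list of the others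
(`NonIntersecting.exists_descending`). A successor of `q` is then the last listed segment hit by the
upward ray (`Descending.isSuccessor`), and free points with the same last hit segment lie in one
face (`faceOf_eq_of_answerCode_eq`). So it suffices to find this index, coded by `answerCode`, and
to look up two words stored for each code.

The index is found in an `r`-ary tree over the list positions, with `r` about `min B n`. At each
node the path goes on to the last child that contains a hit segment. The position of `q.1` relative
to the segments of a node is recorded by the number of their ends to its left. While this number is
constant, the same segments of the node meet the vertical line, so one comparison with the topmost
of them decides whether the node contains a hit (`IsRanking.exists_hit_entry`).

The possible counts of a node are cut into windows of length `2 * r`, with one page per window. The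
page lists, for each child and each count of the child that occurs in the window, an entry pointing
to the window of the child that contains this count. The counts of the children add up to that of
the node, so a page has at most `3 * r` entries (`IsRanking.exists_tree_page`), which is `O(1)`
blocks, and no new search in `x` is needed at the child. Only the window at the root is searched
for, in another `r`-ary tree (`IsRanking.exists_search_page`). Each level has about `n / r` pages,
hence `O(n)` words. Addresses increase with the child number, so the query program follows the
largest pointer among the valid entries (`exec_walk`, `exists_structure`). -/

theorem Seg.convex_carrier (s : Seg) : Convex ℝ s.carrier := convex_segment _ _

theorem Seg.mem_carrier_iff {s : Seg} {z : Point} : z ∈ s.carrier ↔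
    ∃ θ : ℝ, 0 ≤ θ ∧ θ ≤ 1 ∧ z.1 = s.p.1 + θ * (s.q.1 - s.p.1) ∧
      z.2 = s.p.2 + θ * (s.q.2 - s.p.2) := by
  rw [Seg.carrier, segment_eq_image', Set.mem_image]
  constructor
  · rintro ⟨θ, ⟨h0, h1⟩, rfl⟩
    exact ⟨θ, h0, h1, by simp, by simp⟩
  · rintro ⟨θ, h0, h1, hx, hy⟩
    exact ⟨θ, ⟨h0, h1⟩, by ext <;> simp [hx, hy]⟩

theorem Seg.combo_mem {s : Seg} {a b : Point} (ha : a ∈ s.carrier) (hb : b ∈ s.carrier) {l : ℝ}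
    (h0 : 0 ≤ l) (h1 : l ≤ 1) :
    ((1 - l) * a.1 + l * b.1, (1 - l) * a.2 + l * b.2) ∈ s.carrier := by
  have := s.convex_carrier ha hb (sub_nonneg.2 h1) h0 (by ring)
  convert this using 1
  ext <;> simp

/-- Endpoints of a segment are extreme points. -/
theorem Seg.IsEndpoint.eq_of_combo {s : Seg} {z a b : Point} (hz : s.IsEndpoint z)
    (ha : a ∈ s.carrier) (hb : b ∈ s.carrier) {l : ℝ} (h0 : 0 < l) (h1 : l < 1)
    (hx : z.1 = (1 - l) * a.1 + l * b.1) (hy : z.2 = (1 - l) * a.2 + l * b.2) :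
    a = z ∧ b = z := by
  obtain ⟨α, hα0, hα1, ax, ay⟩ := Seg.mem_carrier_iff.1 ha
  obtain ⟨β, hβ0, hβ1, bx, bY⟩ := Seg.mem_carrier_iff.1 hb
  rw [ax, bx] at hx
  rw [ay, bY] at hy
  by_cases hd : s.q.1 - s.p.1 = 0 ∧ s.q.2 - s.p.2 = 0
  · have e : s.p = s.q := Prod.ext (by linarith [hd.1]) (by linarith [hd.2])
    have : z = s.p := by rcases hz with h | h <;> simp [h, e]
    subst this
    rw [hd.1] at ax bx
    rw [hd.2] at ay bY
    exact ⟨Prod.ext (by linarith) (by linarith), Prod.ext (by linarith) (by linarith)⟩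
  -- The direction of `s` is nonzero, so parameters are unique: an average of parameters in `[0, 1]`
  -- with positive weights is `0` or `1` only if both of them are.
  · have key : ∀ c : ℝ, c * (s.q.1 - s.p.1) = 0 → c * (s.q.2 - s.p.2) = 0 → c = 0 := by
      intro c h1 h2
      by_contra hc
      exact hd ⟨(mul_eq_zero.1 h1).resolve_left hc, (mul_eq_zero.1 h2).resolve_left hc⟩
    have hl' : 0 < 1 - l := by linarith
    rcases hz with h | h
    · have hc := key ((1 - l) * α + l * β) (by rw [h] at hx; linarith) (by rw [h] at hy; linarith)
      have h1 : (1 - l) * α = 0 := by nlinarith [mul_nonneg hl'.le hα0, mul_nonneg h0.le hβ0]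
      have h2 : l * β = 0 := by linarith
      have hα : α = 0 := (mul_eq_zero.1 h1).resolve_left hl'.ne'
      have hβ : β = 0 := (mul_eq_zero.1 h2).resolve_left h0.ne'
      subst hα hβ
      exact ⟨Prod.ext (by rw [h]; linarith) (by rw [h]; linarith),
        Prod.ext (by rw [h]; linarith) (by rw [h]; linarith)⟩
    · have hc := key ((1 - l) * (1 - α) + l * (1 - β)) (by rw [h] at hx; linarith)
        (by rw [h] at hy; linarith)
      have p1 := mul_nonneg hl'.le (sub_nonneg.2 hα1)
      have p2 := mul_nonneg h0.le (sub_nonneg.2 hβ1)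
      have hα : 1 - α = 0 := (mul_eq_zero.1 (by linarith : (1 - l) * (1 - α) = 0)).resolve_left hl'.ne'
      have hβ : 1 - β = 0 := (mul_eq_zero.1 (by linarith : l * (1 - β) = 0)).resolve_left h0.ne'
      obtain rfl : α = 1 := by linarith
      obtain rfl : β = 1 := by linarith
      exact ⟨Prod.ext (by rw [h]; linarith) (by rw [h]; linarith),
        Prod.ext (by rw [h]; linarith) (by rw [h]; linarith)⟩

theorem Seg.exists_mem_between {s : Seg} {x₁ x₂ x a b : ℝ} (ha : (x₁, a) ∈ s.carrier)
    (hb : (x₂, b) ∈ s.carrier) (h1 : x₁ ≤ x) (h2 : x ≤ x₂) : ∃ y, (x, y) ∈ s.carrier := by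
  rcases eq_or_lt_of_le (h1.trans h2) with h | h
  · obtain rfl : x₁ = x := le_antisymm h1 (h ▸ h2)
    exact ⟨a, ha⟩
  · have hpos : 0 < x₂ - x₁ := by linarith
    set l := (x - x₁) / (x₂ - x₁) with hl
    refine ⟨(1 - l) * a + l * b, ?_⟩
    have := Seg.combo_mem ha hb (l := l) (by apply div_nonneg <;> linarith)
      (by rw [hl, div_le_one hpos]; linarith)
    convert this using 2
    have : l * (x₂ - x₁) = x - x₁ := by rw [hl]; field_simp
    dsimp only
    linarith

/-- Two different non-intersecting segments do not change their vertical order. -/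
theorem NonIntersecting.le_of_lt {n : ℕ} {S : Fin n → Seg} (hS : NonIntersecting S) {i j : Fin n}
    (hij : i ≠ j) {x₁ x₂ a b a' b' : ℝ} (ha : (x₁, a) ∈ (S i).carrier)
    (hb : (x₁, b) ∈ (S j).carrier) (hab : a < b) (ha' : (x₂, a') ∈ (S i).carrier)
    (hb' : (x₂, b') ∈ (S j).carrier) : a' ≤ b' := by
  by_contra! hlt
  have hD : 0 < (b - a) + (a' - b') := by linarith
  -- The height difference is affine along the two chords and changes sign; `l` is its zero.
  set l := (b - a) / ((b - a) + (a' - b')) with hl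
  have h0 : 0 < l := div_pos (by linarith) hD
  have h1 : l < 1 := by rw [hl, div_lt_one hD]; linarith
  have e : (1 - l) * a + l * a' = (1 - l) * b + l * b' := by
    have : l * ((b - a) + (a' - b')) = b - a := by rw [hl]; field_simp
    linarith
  have m1 := Seg.combo_mem ha ha' h0.le h1.le
  have m2 := Seg.combo_mem hb hb' h0.le h1.le
  dsimp only at m1 m2
  rw [e] at m1
  -- The common point is an endpoint of both segments and strictly inside both chords, so both
  -- chords collapse to it, against `a < b`.
  obtain ⟨e1, e2⟩ := hS i j hij _ m1 m2
  have r1 := (e1.eq_of_combo ha ha' h0 h1 rfl e.symm).1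
  have r2 := (e2.eq_of_combo hb hb' h0 h1 rfl rfl).1
  have := congrArg Prod.snd (r1.trans r2.symm)
  simp at this
  linarith

/-! ### A linear order compatible with the vertical order -/

/-- The place for `s` is just before the first element that it precedes. An element from there on
that preceded `s` would, by composition, precede that element, against the order of the list. -/
theorem exists_insertion {α : Type*} (lt : α → α → Prop) (irr : ∀ a, ¬ lt a a) (s : α) :
    ∀ l : List α, (∀ t ∈ l, ∀ u ∈ l, lt t s → lt s u → lt t u) →
      l.Pairwise (fun a b => ¬ lt b a) →
      ∃ l₁ l₂, l = l₁ ++ l₂ ∧ (∀ u ∈ l₁, ¬ lt s u) ∧ ∀ t ∈ l₂, ¬ lt t s := by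
  intro l
  induction l with
  | nil => exact fun _ _ => ⟨[], [], rfl, by simp, by simp⟩
  | cons a l ih =>
    intro h hp
    rw [List.pairwise_cons] at hp
    by_cases hsa : lt s a
    · refine ⟨[], a :: l, rfl, by simp, ?_⟩
      intro t ht hts
      have hta := h t ht a (by simp) hts hsa
      rcases List.mem_cons.1 ht with rfl | ht
      · exact irr _ hta
      · exact hp.1 t ht hta
    · obtain ⟨l₁, l₂, rfl, h1, h2⟩ := ih
        (fun t ht u hu => h t (List.mem_cons_of_mem _ ht) u (List.mem_cons_of_mem _ hu)) hp.2
      refine ⟨a :: l₁, l₂, rfl, ?_, h2⟩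
      intro u hu
      rcases List.mem_cons.1 hu with rfl | hu
      · exact hsa
      · exact h1 u hu

/-- A relation that can be composed over the element with the smallest key extends to a linear
order. -/
theorem exists_list_pairwise {α : Type*} [DecidableEq α] (lt : α → α → Prop) (key : α → ℝ)
    (irr : ∀ a, ¬ lt a a)
    (h : ∀ s t u, key s ≤ key t → key s ≤ key u → lt t s → lt s u → lt t u) (A : Finset α) :
    ∃ l : List α, l.Nodup ∧ (∀ a, a ∈ l ↔ a ∈ A) ∧ l.Pairwise (fun a b => ¬ lt b a) := by
  induction A using Finset.strongInduction with
  | H A ih =>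
    rcases A.eq_empty_or_nonempty with rfl | hA
    · exact ⟨[], by simp, by simp, by simp⟩
    -- As `s` has the smallest key, composition over `s` is available for all pairs of other
    -- elements, and `s` can be inserted into their list.
    · obtain ⟨s, hs, hmin⟩ := A.exists_min_image key hA
      obtain ⟨l, hnd, hmem, hp⟩ := ih (A.erase s) (Finset.erase_ssubset hs)
      have hin : ∀ t ∈ l, t ∈ A := fun t ht => Finset.mem_of_mem_erase ((hmem t).1 ht)
      obtain ⟨l₁, l₂, rfl, h1, h2⟩ := exists_insertion lt irr s l
        (fun t ht u hu => h s t u (hmin t (hin t ht)) (hmin u (hin u hu))) hp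
      have hsl : s ∉ l₁ ++ l₂ := fun hc => by simpa using (hmem s).1 hc
      have hperm : (l₁ ++ s :: l₂).Perm (s :: (l₁ ++ l₂)) := List.perm_middle
      refine ⟨l₁ ++ s :: l₂, hperm.nodup_iff.2 (List.nodup_cons.2 ⟨hsl, hnd⟩), ?_, ?_⟩
      · intro a
        rw [hperm.mem_iff, List.mem_cons, hmem, Finset.mem_erase]
        by_cases e : a = s
        · simp [e, hs]
        · simp [e]
      · rw [List.pairwise_append] at hp ⊢
        refine ⟨hp.1, List.pairwise_cons.2 ⟨h2, hp.2.1⟩, ?_⟩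
        intro a ha b hb
        rcases List.mem_cons.1 hb with rfl | hb
        · exact h1 a ha
        · exact hp.2.2 a ha b hb

theorem Seg.exists_rightmost (s : Seg) : ∃ ξ η : ℝ, (ξ, η) ∈ s.carrier ∧
    ∀ x y, (x, y) ∈ s.carrier → x ≤ ξ := by
  have hp : s.p ∈ s.carrier := left_mem_segment ℝ _ _
  have hq : s.q ∈ s.carrier := right_mem_segment ℝ _ _
  rcases le_total s.p.1 s.q.1 with h | h
  · refine ⟨s.q.1, s.q.2, hq, fun x y hxy => ?_⟩
    obtain ⟨θ, h0, h1, hx, -⟩ := Seg.mem_carrier_iff.1 hxy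
    dsimp only at hx
    nlinarith
  · refine ⟨s.p.1, s.p.2, hp, fun x y hxy => ?_⟩
    obtain ⟨θ, h0, h1, hx, -⟩ := Seg.mem_carrier_iff.1 hxy
    dsimp only at hx
    nlinarith

/-- The segments are listed from top to bottom. -/
def Descending {n : ℕ} (T : Fin n → Seg) : Prop :=
  ∀ a b, a < b → ∀ x v w, (x, v) ∈ (T a).carrier → (x, w) ∈ (T b).carrier → w ≤ v

/-- The key is the abscissa of the right end. If `t` is above `s` on one line, `s` is above `u` on
another, and `s` ends first, then both lines are left of the ends of `t` and `u`. So the segment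
seen on the left line, `t` or `u`, reaches the right line, where `t`, `s`, `u` meet in this order.
-/
theorem NonIntersecting.exists_descending {n : ℕ} {S : Fin n → Seg} (hS : NonIntersecting S) :
    ∃ e : Fin n ≃ Fin n, Descending (fun a => S (e a)) := by
  choose ξ η hξ hmax using fun i => (S i).exists_rightmost
  let lt : Fin n → Fin n → Prop := fun t s =>
    t ≠ s ∧ ∃ x v w, (x, v) ∈ (S t).carrier ∧ (x, w) ∈ (S s).carrier ∧ w < v
  obtain ⟨l, hnd, hmem, hp⟩ := exists_list_pairwise lt ξ (fun a h => h.1 rfl) (by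
    rintro s t u hst hsu ⟨hts, x₁, a, b, ha, hb, hab⟩ ⟨hsu', x₂, c, d, hc, hd, hcd⟩
    have htu : t ≠ u := by
      rintro rfl
      exact absurd (hS.le_of_lt hts.symm hb ha hab hc hd) (not_le.2 hcd)
    refine ⟨htu, ?_⟩
    rcases le_total x₁ x₂ with h | h
    · obtain ⟨y, hy⟩ := Seg.exists_mem_between ha (hξ t) h ((hmax s _ _ hc).trans hst)
      exact ⟨x₂, y, d, hy, hd, hcd.trans_le (hS.le_of_lt hts.symm hb ha hab hc hy)⟩
    · obtain ⟨y, hy⟩ := Seg.exists_mem_between hd (hξ u) h ((hmax s _ _ hb).trans hsu)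
      exact ⟨x₁, a, y, ha, hy, (hS.le_of_lt hsu'.symm hd hc hcd hy hb).trans_lt hab⟩) Finset.univ
  have hall : ∀ a, a ∈ l := fun a => (hmem a).2 (Finset.mem_univ a)
  have hlen : l.length = n := by
    have := List.toFinset_card_of_nodup hnd
    rw [← this, Finset.eq_univ_of_forall (fun a => List.mem_toFinset.2 (hall a)), Finset.card_fin]
  refine ⟨(finCongr hlen.symm).trans (hnd.getEquivOfForallMemList l hall), ?_⟩
  intro a b hab x v w hv hw
  have := List.pairwise_iff_get.1 hp (Fin.cast hlen.symm a) (Fin.cast hlen.symm b) hab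
  by_contra! hlt
  refine this ⟨?_, x, w, v, hw, hv, hlt⟩
  intro e
  have := (hnd.get_inj_iff).1 e
  simp at this
  exact hab.ne' this


/-! ### Left and right endpoints -/

/-- The segment with the same endpoints in lexicographic order. -/
noncomputable def Seg.norm (s : Seg) : Seg :=
  open Classical in
  if s.p.1 < s.q.1 ∨ (s.p.1 = s.q.1 ∧ s.p.2 ≤ s.q.2) then s else ⟨s.q, s.p⟩

theorem Seg.norm_carrier (s : Seg) : s.norm.carrier = s.carrier := by
  unfold Seg.norm
  split_ifs
  · rfl
  · exact segment_symm ℝ _ _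

theorem Seg.norm_le (s : Seg) : s.norm.p.1 ≤ s.norm.q.1 := by
  unfold Seg.norm
  split_ifs with h
  · rcases h with h | h
    · exact h.le
    · exact h.1.le
  · push Not at h
    exact h.1

theorem Seg.norm_le_of_eq (s : Seg) (he : s.norm.p.1 = s.norm.q.1) :
    s.norm.p.2 ≤ s.norm.q.2 := by
  unfold Seg.norm at he ⊢
  split_ifs at he ⊢ with h
  · rcases h with h | h
    · exact absurd he h.ne
    · exact h.2
  · push Not at h
    exact (h.2 he.symm).le

theorem Seg.exists_mem_iff (s : Seg) (x : ℝ) :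
    (∃ y, (x, y) ∈ s.carrier) ↔ s.norm.p.1 ≤ x ∧ x ≤ s.norm.q.1 := by
  rw [← s.norm_carrier]
  have hn := s.norm_le
  generalize s.norm = t at *
  constructor
  · rintro ⟨y, h⟩
    obtain ⟨θ, h0, h1, hx, -⟩ := Seg.mem_carrier_iff.1 h
    dsimp only at hx
    constructor <;> nlinarith
  · rintro ⟨h1, h2⟩
    exact Seg.exists_mem_between (a := t.p.2) (b := t.q.2) (left_mem_segment ℝ _ _)
      (right_mem_segment ℝ _ _) h1 h2

/-- The upward vertical ray from `q` hits the segment `s`. -/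
def Seg.Hit (s : Seg) (q : Point) : Prop := ∃ y, q.2 ≤ y ∧ (q.1, y) ∈ s.carrier

/-- The arithmetic test for `Seg.Hit`, for segments with endpoints in lexicographic order that meet
the vertical line through `q`. -/
def Seg.Above (s : Seg) (q : Point) : Prop :=
  (s.p.1 < s.q.1 → (q.2 - s.p.2) * (s.q.1 - s.p.1) ≤ (q.1 - s.p.1) * (s.q.2 - s.p.2)) ∧
    (¬ s.p.1 < s.q.1 → q.2 ≤ s.q.2)

/-- The comparison of `q.2` with the height of the segment is multiplied by the positive width, so
no division is needed. For a vertical segment only the upper endpoint matters, which is the second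
one in lexicographic order. -/
theorem Seg.hit_iff (s : Seg) (q : Point) (h : ∃ y, (q.1, y) ∈ s.carrier) :
    s.Hit q ↔ s.norm.Above q := by
  rw [s.exists_mem_iff] at h
  unfold Seg.Hit
  rw [← s.norm_carrier]
  have hn := s.norm_le_of_eq
  generalize s.norm = t at *
  unfold Seg.Above
  constructor
  · rintro ⟨y, hy, hm⟩
    obtain ⟨θ, h0, h1, hx, hz⟩ := Seg.mem_carrier_iff.1 hm
    dsimp only at hx hz
    refine ⟨fun hlt => ?_, fun hlt => ?_⟩
    · have : (q.1 - t.p.1) * (t.q.2 - t.p.2) = (y - t.p.2) * (t.q.1 - t.p.1) := by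
        rw [hx, hz]; ring
      rw [this]
      exact mul_le_mul_of_nonneg_right (by linarith) (by linarith)
    · have := hn (le_antisymm (h.1.trans h.2) (not_lt.1 hlt))
      nlinarith
  · rintro ⟨h1, h2⟩
    by_cases hlt : t.p.1 < t.q.1
    · have hpos : 0 < t.q.1 - t.p.1 := by linarith
      refine ⟨t.p.2 + (q.1 - t.p.1) / (t.q.1 - t.p.1) * (t.q.2 - t.p.2), ?_, ?_⟩
      · have := h1 hlt
        rw [div_mul_eq_mul_div, ← sub_le_iff_le_add', le_div_iff₀ hpos]
        exact this
      · refine Seg.mem_carrier_iff.2 ⟨(q.1 - t.p.1) / (t.q.1 - t.p.1), ?_, ?_, ?_, rfl⟩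
        · apply div_nonneg <;> linarith
        · rw [div_le_one hpos]; linarith
        · dsimp only
          field_simp
          ring
    · refine ⟨t.q.2, h2 hlt, ?_⟩
      have : q.1 = t.q.1 := le_antisymm h.2 ((not_lt.1 hlt).trans h.1)
      rw [this]
      exact right_mem_segment ℝ _ _

/-! ### The answer to a query -/

section Answer

variable {n : ℕ} (T : Fin n → Seg)

open Classical in
/-- The code of the answer at `q`: `a + 1` for the last segment `a` hit by the upward ray, and `0`
if there is none. -/
noncomputable def answerCode (q : Point) : ℕ :=
  (Finset.univ.filter fun a => (T a).Hit q).sup fun a => (a : ℕ) + 1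

variable {T}

theorem Seg.Hit.lt_answerCode {q : Point} {a : Fin n} (h : (T a).Hit q) :
    (a : ℕ) + 1 ≤ answerCode T q := by
  classical
  exact Finset.le_sup (f := fun a : Fin n => (a : ℕ) + 1) (by simpa using h)

theorem answerCode_eq_succ_iff {q : Point} {a : Fin n} :
    answerCode T q = (a : ℕ) + 1 ↔ (T a).Hit q ∧ ∀ b, (T b).Hit q → b ≤ a := by
  classical
  constructor
  · intro h
    have hne : (Finset.univ.filter fun a => (T a).Hit q).Nonempty := by
      by_contra hc
      rw [Finset.not_nonempty_iff_eq_empty] at hc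
      rw [answerCode, hc] at h
      simp at h
    obtain ⟨b, hb, hbe⟩ := Finset.exists_mem_eq_sup _ hne (fun a : Fin n => (a : ℕ) + 1)
    have : b = a := by
      apply Fin.ext
      have := hbe.symm.trans h
      omega
    subst this
    refine ⟨by simpa using hb, fun c hc => ?_⟩
    have := hc.lt_answerCode
    rw [Fin.le_def]
    omega
  · rintro ⟨h1, h2⟩
    refine le_antisymm (Finset.sup_le fun b hb => ?_) h1.lt_answerCode
    have := h2 b (by simpa using hb)
    rw [Fin.le_def] at this
    omega

theorem answerCode_eq_zero_iff {q : Point} : answerCode T q = 0 ↔ ∀ a, ¬ (T a).Hit q := by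
  classical
  constructor
  · intro h a ha
    have := ha.lt_answerCode
    omega
  · intro h
    have : (Finset.univ.filter fun a => (T a).Hit q) = ∅ := by
      ext a; simpa using h a
    rw [answerCode, this]
    rfl

theorem answerCode_cases (T : Fin n → Seg) (q : Point) :
    answerCode T q = 0 ∨ ∃ a : Fin n, answerCode T q = (a : ℕ) + 1 := by
  classical
  by_cases hne : (Finset.univ.filter fun a => (T a).Hit q).Nonempty
  · obtain ⟨b, hb, hbe⟩ := Finset.exists_mem_eq_sup _ hne (fun a : Fin n => (a : ℕ) + 1)
    exact Or.inr ⟨b, hbe⟩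
  · rw [Finset.not_nonempty_iff_eq_empty] at hne
    left
    rw [answerCode, hne]
    rfl

/-- A vertical segment may be hit at many heights; compactness gives the lowest. -/
theorem Seg.Hit.exists_first {s : Seg} {q : Point} (h : s.Hit q) :
    ∃ y, q.2 ≤ y ∧ (q.1, y) ∈ s.carrier ∧ ∀ y', q.2 ≤ y' → (q.1, y') ∈ s.carrier → y ≤ y' := by
  have hc : IsCompact s.carrier := by
    rw [Seg.carrier, segment_eq_image']
    exact isCompact_Icc.image (by fun_prop)
  have hK : IsCompact (s.carrier ∩ {z | z.1 = q.1 ∧ q.2 ≤ z.2}) := by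
    refine hc.inter_right ?_
    exact (isClosed_eq continuous_fst continuous_const).inter
      (isClosed_le continuous_const continuous_snd)
  obtain ⟨y₀, h0, hm0⟩ := h
  obtain ⟨⟨x, y⟩, ⟨hm, hx, hy⟩, hmin⟩ := hK.exists_isMinOn ⟨(q.1, y₀), hm0, rfl, h0⟩
    continuous_snd.continuousOn
  dsimp only at hx hy
  subst hx
  exact ⟨y, hy, hm, fun y' h1 h2 => hmin ⟨h2, rfl, h1⟩⟩

/-- Every other hit segment comes earlier in the list, so it is nowhere below segment `a` on the
line. -/
theorem Descending.isSuccessor (hT : Descending T) {q : Point} {a : Fin n}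
    (h : answerCode T q = (a : ℕ) + 1) : IsSuccessor T q a := by
  obtain ⟨h1, h2⟩ := answerCode_eq_succ_iff.1 h
  obtain ⟨y, hy, hm, hmin⟩ := h1.exists_first
  refine ⟨y, ⟨hy, hm⟩, fun j y' hj => ?_⟩
  rcases (h2 j ⟨y', hj.1, hj.2⟩).lt_or_eq with hlt | rfl
  · exact hT j a hlt _ _ _ hj.2 hm
  · exact hmin y' hj.1 hj.2

/-! ### Queries with the same answer lie in the same face -/

theorem faceOf_eq_of_segment {a b : Point} (h : segment ℝ a b ⊆ freeSpace T) :
    faceOf T a = faceOf T b := by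
  refine connectedComponentIn_eq ?_
  exact (convex_segment a b).isPreconnected.subset_connectedComponentIn (left_mem_segment ℝ a b) h
    (right_mem_segment ℝ a b)

theorem mem_freeSpace {z : Point} : z ∈ freeSpace T ↔ ∀ a, z ∉ (T a).carrier := by
  simp [freeSpace]

theorem mem_segment_vertical {x y y' : ℝ} {z : Point} (h : z ∈ segment ℝ (x, y) (x, y')) :
    z.1 = x ∧ min y y' ≤ z.2 ∧ z.2 ≤ max y y' := by
  obtain ⟨θ, h0, h1, hx, hy⟩ := (Seg.mem_carrier_iff (s := ⟨(x, y), (x, y')⟩)).1 h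
  dsimp only at hx hy
  refine ⟨by linarith, ?_, ?_⟩
  · rcases le_total y y' with h | h
    · rw [min_eq_left h]; nlinarith
    · rw [min_eq_right h]; nlinarith
  · rcases le_total y y' with h | h
    · rw [max_eq_right h]; nlinarith
    · rw [max_eq_left h]; nlinarith

theorem faceOf_eq_of_vertical {x y y' : ℝ} (hle : y ≤ y')
    (h : ∀ w, y ≤ w → w ≤ y' → ∀ a, (x, w) ∉ (T a).carrier) :
    faceOf T (x, y) = faceOf T (x, y') := by
  refine faceOf_eq_of_segment fun z hz => mem_freeSpace.2 fun a ha => ?_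
  obtain ⟨h1, h2, h3⟩ := mem_segment_vertical hz
  rw [min_eq_left hle] at h2
  rw [max_eq_right hle] at h3
  refine h z.2 h2 h3 a ?_
  rw [← h1]
  exact ha

/-- Both points escape straight up to a height above all endpoints, where they are joined
horizontally. -/
theorem faceOf_eq_of_answerCode_zero {q q' : Point} (h : answerCode T q = 0)
    (h' : answerCode T q' = 0) : faceOf T q = faceOf T q' := by
  rw [answerCode_eq_zero_iff] at h h'
  obtain ⟨Y, hY⟩ : ∃ Y, Y ∈ upperBounds (insert q.2 (insert q'.2
      (⋃ a : Fin n, {(T a).p.2, (T a).q.2}))) := by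
    apply Set.Finite.bddAbove
    refine Set.Finite.insert _ (Set.Finite.insert _ (Set.finite_iUnion fun a => ?_))
    exact Set.toFinite _
  have hq : q.2 ≤ Y := hY (by simp)
  have hq' : q'.2 ≤ Y := hY (by simp)
  have hp : ∀ a, (T a).p.2 ≤ Y := fun a => hY (by simp; exact Or.inr (Or.inr ⟨a, Or.inl rfl⟩))
  have hr : ∀ a, (T a).q.2 ≤ Y := fun a => hY (by simp; exact Or.inr (Or.inr ⟨a, Or.inr rfl⟩))
  have up : ∀ q : Point, (∀ a, ¬ (T a).Hit q) → q.2 ≤ Y → faceOf T q = faceOf T (q.1, Y + 1) := by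
    intro q hq hY
    refine faceOf_eq_of_vertical (x := q.1) (y := q.2) (by linarith) ?_
    intro w h1 _ a ha
    exact hq a ⟨w, h1, ha⟩
  rw [up q h hq, up q' h' hq']
  refine faceOf_eq_of_segment fun z hz => mem_freeSpace.2 fun a ha => ?_
  obtain ⟨θ, -, -, -, hy⟩ := (Seg.mem_carrier_iff (s := ⟨(q.1, Y + 1), (q'.1, Y + 1)⟩)).1 hz
  obtain ⟨θ', h0, h1, -, hy'⟩ := Seg.mem_carrier_iff.1 ha
  dsimp only at hy hy'
  nlinarith [hp a, hr a]

theorem Seg.snd_unique {s : Seg} {x x' u v v' w w' : ℝ} (hx : x ≠ x') (h1 : (x, w) ∈ s.carrier)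
    (h2 : (x', w') ∈ s.carrier) (h3 : (u, v) ∈ s.carrier) (h4 : (u, v') ∈ s.carrier) :
    v = v' := by
  obtain ⟨a, -, -, ax, ay⟩ := Seg.mem_carrier_iff.1 h1
  obtain ⟨b, -, -, bx, bY⟩ := Seg.mem_carrier_iff.1 h2
  obtain ⟨c, -, -, cx, cy⟩ := Seg.mem_carrier_iff.1 h3
  obtain ⟨d, -, -, dx, dy⟩ := Seg.mem_carrier_iff.1 h4
  dsimp only at *
  have hne : s.q.1 - s.p.1 ≠ 0 := by
    intro h
    rw [h] at ax bx
    exact hx (by linarith)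
  have : (c - d) * (s.q.1 - s.p.1) = 0 := by linarith
  have : c = d := by linarith [(mul_eq_zero.1 this).resolve_right hne]
  subst this
  linarith

/-- The points slightly below a portion of a segment are free if the portion ends at hits of two
queries answered by this segment. -/
theorem exists_shift_free (hS : NonIntersecting T) (hT : Descending T) {q q' : Point} {a : Fin n}
    (h : ∀ b, (T b).Hit q → b ≤ a) (h' : ∀ b, (T b).Hit q' → b ≤ a) (hx : q.1 ≠ q'.1)
    {v v' : ℝ} (hv : q.2 ≤ v) (hm : (q.1, v) ∈ (T a).carrier) (hv' : q'.2 ≤ v')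
    (hm' : (q'.1, v') ∈ (T a).carrier) (b : Fin n) :
    ∃ ε₀ > 0, ∀ ε, 0 < ε → ε < ε₀ → ∀ z ∈ segment ℝ (q.1, v) (q'.1, v'),
      (z.1, z.2 - ε) ∉ (T b).carrier := by
  have hsub : segment ℝ (q.1, v) (q'.1, v') ⊆ (T a).carrier :=
    (T a).convex_carrier.segment_subset hm hm'
  by_cases hba : b = a
  · subst hba
    refine ⟨1, one_pos, fun ε h0 _ z hz hc => ?_⟩
    have := Seg.snd_unique hx hm hm' (hsub hz : (z.1, z.2) ∈ _) hc
    linarith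
  · by_cases hbelow : ∃ z ∈ segment ℝ (q.1, v) (q'.1, v'), ∃ δ > 0, (z.1, z.2 - δ) ∈ (T b).carrier
    -- Segment `b` passes below segment `a`, so it comes later in the list and is hit neither from
    -- `q` nor from `q'`. It cannot touch the portion: at its two ends this would be such a hit, and
    -- elsewhere an endpoint of segment `a` would lie strictly inside it. Compactness leaves a gap.
    · obtain ⟨z, hz, δ, hδ, hzb⟩ := hbelow
      have hnb : ¬ b ≤ a := by
        intro hle
        have := hT b a (lt_of_le_of_ne hle hba) _ _ _ hzb (hsub hz : (z.1, z.2) ∈ _)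
        linarith
      have hdis : Disjoint (segment ℝ (q.1, v) (q'.1, v')) (T b).carrier := by
        rw [Set.disjoint_left]
        intro w hw hwb
        have hend := (hS b a hba w hwb (hsub hw)).2
        obtain ⟨θ, h0, h1, wx, wy⟩ :=
          (Seg.mem_carrier_iff (s := ⟨(q.1, v), (q'.1, v')⟩)).1 hw
        dsimp only at wx wy
        rcases h0.eq_or_lt with rfl | h0
        · refine hnb (h b ⟨w.2, by linarith, ?_⟩)
          have : w.1 = q.1 := by linarith
          rw [← this]
          exact hwb
        rcases h1.eq_or_lt with rfl | h1
        · refine hnb (h' b ⟨w.2, by linarith, ?_⟩)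
          have : w.1 = q'.1 := by linarith
          rw [← this]
          exact hwb
        · obtain ⟨e1, e2⟩ := hend.eq_of_combo hm hm' h0 h1 (by dsimp only; linarith)
            (by dsimp only; linarith)
          exact hx (by simpa using congrArg Prod.fst (e1.trans e2.symm))
      have hcomp : ∀ s : Seg, IsCompact s.carrier := by
        intro s
        rw [Seg.carrier, segment_eq_image']
        exact isCompact_Icc.image (by fun_prop)
      obtain ⟨r, hr, hfar⟩ := Metric.exists_pos_forall_lt_edist
        (hcomp ⟨(q.1, v), (q'.1, v')⟩) (hcomp (T b)).isClosed hdis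
      refine ⟨r, by exact_mod_cast hr, fun ε h0 h1 z hz hc => ?_⟩
      have := hfar z hz _ hc
      rw [edist_dist, Prod.dist_eq, Real.dist_eq, Real.dist_eq] at this
      simp only [sub_self, abs_zero, sub_sub_cancel, abs_of_pos h0, max_eq_right h0.le] at this
      rw [← ENNReal.ofReal_coe_nnreal, ENNReal.ofReal_lt_ofReal_iff h0] at this
      linarith
    · push Not at hbelow
      exact ⟨1, one_pos, fun ε h0 _ z hz => hbelow z hz ε h0⟩

/-- Points on one vertical line are joined directly. Otherwise both points climb to distance `ε`
below the common successor segment, which is not vertical, and are joined along it at this distance.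
-/
theorem faceOf_eq_of_answerCode_eq (hS : NonIntersecting T) (hT : Descending T) {q q' : Point}
    (hq : q ∈ freeSpace T) (hq' : q' ∈ freeSpace T) (h : answerCode T q = answerCode T q') :
    faceOf T q = faceOf T q' := by
  rcases answerCode_cases T q with h0 | ⟨a, ha⟩
  · exact faceOf_eq_of_answerCode_zero h0 (h ▸ h0)
  have ha' := h ▸ ha
  obtain ⟨⟨v, hv, hm⟩, hmax⟩ := answerCode_eq_succ_iff.1 ha
  obtain ⟨⟨v', hv', hm'⟩, hmax'⟩ := answerCode_eq_succ_iff.1 ha'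
  rw [mem_freeSpace] at hq hq'
  have hlt : ∀ {q : Point} {v}, (∀ a, q ∉ (T a).carrier) → q.2 ≤ v → (q.1, v) ∈ (T a).carrier →
      q.2 < v := by
    intro q v hq hv hm
    refine lt_of_le_of_ne hv ?_
    rintro rfl
    exact hq a hm
  by_cases hx : q.1 = q'.1
  · have main : ∀ (q q' : Point) (v v' : ℝ), (∀ a, q ∉ (T a).carrier) → (∀ a, q' ∉ (T a).carrier) →
        (∀ b, (T b).Hit q → b ≤ a) → q'.2 ≤ v' → (q'.1, v') ∈ (T a).carrier → q.1 = q'.1 →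
        q.2 ≤ q'.2 → faceOf T q = faceOf T q' := by
      intro q q' v v' hq hq' hmax hv' hm' hx hle
      have hv'' := hlt hq' hv' hm'
      have : faceOf T (q.1, q.2) = faceOf T (q.1, q'.2) := by
        refine faceOf_eq_of_vertical hle fun w h1 h2 b hb => ?_
        rcases (hmax b ⟨w, h1, hb⟩).lt_or_eq with hba | rfl
        · have := hT b a hba _ _ _ hb (hx ▸ hm')
          linarith
        · refine hq' b ?_
          rw [hx] at hb
          have := (T b).convex_carrier.segment_subset hb hm'
          apply this
          refine (Seg.mem_carrier_iff (s := ⟨(q'.1, w), (q'.1, v')⟩)).2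
            ⟨(q'.2 - w) / (v' - w), ?_, ?_, by simp, ?_⟩
          · apply div_nonneg <;> linarith
          · rw [div_le_one (by linarith)]; linarith
          · dsimp only
            rw [div_mul_cancel₀ _ (by linarith)]
            ring
      have e : (q.1, q'.2) = q' := Prod.ext hx rfl
      rw [e] at this
      exact this
    rcases le_total q.2 q'.2 with hle | hle
    · exact main q q' v v' hq hq' hmax hv' hm' hx hle
    · exact (main q' q v' v hq' hq hmax' hv hm hx.symm hle).symm
  · choose ε₀ hε₀ hfree using exists_shift_free hS hT hmax hmax' hx hv hm hv' hm'
    have hlv := hlt hq hv hm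
    have hlv' := hlt hq' hv' hm'
    obtain ⟨ε, hε, hle⟩ : ∃ ε, 0 < ε ∧ (∀ b, ε < ε₀ b) ∧ ε < v - q.2 ∧ ε < v' - q'.2 := by
      have h1 : ∀ᶠ ε in nhdsWithin (0 : ℝ) (Set.Ioi 0), ∀ b, ε < ε₀ b :=
        Filter.eventually_all.2 fun b => nhdsWithin_le_nhds (eventually_lt_nhds (hε₀ b))
      have h2 : ∀ᶠ ε in nhdsWithin (0 : ℝ) (Set.Ioi 0), ε < v - q.2 :=
        nhdsWithin_le_nhds (eventually_lt_nhds (by linarith))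
      have h3 : ∀ᶠ ε in nhdsWithin (0 : ℝ) (Set.Ioi 0), ε < v' - q'.2 :=
        nhdsWithin_le_nhds (eventually_lt_nhds (by linarith))
      obtain ⟨ε, h⟩ := ((h1.and (h2.and h3)).and self_mem_nhdsWithin).exists
      exact ⟨ε, h.2, h.1⟩
    obtain ⟨hb, he, he'⟩ := hle
    have up : ∀ (q : Point) (v : ℝ), (∀ b, (T b).Hit q → b ≤ a) → (q.1, v) ∈ (T a).carrier →
        ε < v - q.2 → faceOf T q = faceOf T (q.1, v - ε) := by
      intro q v hmax hmv he
      refine faceOf_eq_of_vertical (x := q.1) (y := q.2) (by linarith) fun w h1 h2 b hb => ?_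
      rcases (hmax b ⟨w, h1, hb⟩).lt_or_eq with hba | rfl
      · have := hT b a hba _ _ _ hb hmv
        linarith
      · have := Seg.snd_unique hx hm hm' hb hmv
        linarith
    rw [up q v hmax hm he, up q' v' hmax' hm' he']
    refine faceOf_eq_of_segment fun z hz => mem_freeSpace.2 fun b hzb => ?_
    obtain ⟨θ, h0, h1, zx, zy⟩ :=
      (Seg.mem_carrier_iff (s := ⟨(q.1, v - ε), (q'.1, v' - ε)⟩)).1 hz
    refine hfree b ε hε (hb b) (z.1, z.2 + ε) ?_ (by simpa using hzb)
    refine (Seg.mem_carrier_iff (s := ⟨(q.1, v), (q'.1, v')⟩)).2 ⟨θ, h0, h1, zx, ?_⟩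
    dsimp only at zy ⊢
    linarith

/-- Identifiers for the faces: the code of the answers to the queries in the face. -/
theorem exists_faceId (hS : NonIntersecting T) (hT : Descending T) :
    ∃ (faceId : Set Point → ℤ) (Φ : ℕ → ℤ), Set.InjOn faceId (faces T) ∧
      (∀ q ∈ freeSpace T, faceId (faceOf T q) = Φ (answerCode T q)) ∧
      ∀ m, 0 ≤ Φ m ∧ Φ m ≤ n := by
  have hle : ∀ q, answerCode T q ≤ n := by
    intro q
    rcases answerCode_cases T q with h | ⟨a, h⟩ <;> omega
  classical
  -- The identifier is the code of one chosen point of the face. A face may show several codes, so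
  -- `Φ` translates each code into the chosen one.
  let faceId : Set Point → ℤ := fun F =>
    if h : ∃ q ∈ freeSpace T, faceOf T q = F then answerCode T h.choose else 0
  let Φ : ℕ → ℤ := fun m =>
    if h : ∃ q ∈ freeSpace T, answerCode T q = m then faceId (faceOf T h.choose) else 0
  have hid : ∀ q ∈ freeSpace T, ∃ q' ∈ freeSpace T, faceOf T q' = faceOf T q ∧
      faceId (faceOf T q) = answerCode T q' := by
    intro q hq
    have h : ∃ q' ∈ freeSpace T, faceOf T q' = faceOf T q := ⟨q, hq, rfl⟩
    exact ⟨h.choose, h.choose_spec.1, h.choose_spec.2, dif_pos h⟩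
  refine ⟨faceId, Φ, ?_, ?_, ?_⟩
  · rintro _ ⟨q₁, h₁, rfl⟩ _ ⟨q₂, h₂, rfl⟩ he
    obtain ⟨q₁', h₁', e₁, i₁⟩ := hid q₁ h₁
    obtain ⟨q₂', h₂', e₂, i₂⟩ := hid q₂ h₂
    rw [← e₁, ← e₂]
    refine faceOf_eq_of_answerCode_eq hS hT h₁' h₂' ?_
    have := i₁.symm.trans (he.trans i₂)
    exact_mod_cast this
  · intro q hq
    have h : ∃ q' ∈ freeSpace T, answerCode T q' = answerCode T q := ⟨q, hq, rfl⟩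
    have : Φ (answerCode T q) = faceId (faceOf T h.choose) := dif_pos h
    rw [this, faceOf_eq_of_answerCode_eq hS hT h.choose_spec.1 hq h.choose_spec.2]
  · intro m
    by_cases h : ∃ q ∈ freeSpace T, answerCode T q = m
    · have : Φ m = faceId (faceOf T h.choose) := dif_pos h
      rw [this]
      obtain ⟨q', -, -, e⟩ := hid _ h.choose_spec.1
      rw [e]
      exact ⟨by positivity, by exact_mod_cast hle q'⟩
    · have : Φ m = 0 := dif_neg h
      rw [this]
      exact ⟨le_rfl, by positivity⟩

end Answer


/-! ### Search pages on disk -/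

/-- A cut of the `x`-axis at or right after a coordinate, or at infinity. -/
inductive Cut where
  | always
  | ins (x : ℝ)
  | del (x : ℝ)
  | never

/-- The cut is to the left of the vertical line at `x`. -/
def Cut.Before : Cut → ℝ → Prop
  | .always, _ => True
  | .ins a, x => a ≤ x
  | .del a, x => a < x
  | .never, _ => False

/-- `cutCmd` tells the kinds apart by comparison with `1`, `2`, `3`, and inspects the second word
only for kinds `1` and `2`, where it is real. -/
def Cut.kind : Cut → ℕ
  | .always => 0
  | .ins _ => 1
  | .del _ => 2
  | .never => 3

def Cut.word : Cut → Word
  | .always => .int 0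
  | .ins x => .real x
  | .del x => .real x
  | .never => .int 0

/-- An entry of a search page: a query between the two cuts and below the segment may go on to
the address `ptr`. -/
structure Rec where
  lo : Cut
  hi : Cut
  seg : Option Seg
  ptr : ℕ

def Rec.Valid (r : Rec) (q : Point) : Prop :=
  r.lo.Before q.1 ∧ ¬ r.hi.Before q.1 ∧ ∀ s ∈ r.seg, s.Above q

/-- The ten words of an entry. -/
def Rec.field (r : Rec) : ℕ → Word
  | 0 => .int r.lo.kind
  | 1 => r.lo.word
  | 2 => .int r.hi.kind
  | 3 => r.hi.word
  | 4 => r.seg.elim (.int 0) fun _ => .int 1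
  | 5 => r.seg.elim (.int 0) fun s => .real s.p.1
  | 6 => r.seg.elim (.int 0) fun s => .real s.p.2
  | 7 => r.seg.elim (.int 0) fun s => .real s.q.1
  | 8 => r.seg.elim (.int 0) fun s => .real s.q.2
  | 9 => .int r.ptr
  | _ => .int 0

/-- The word at address `a`. -/
def diskAt (disk : List Word) (a : ℕ) : Word := disk.getD a (.int 0)

/-- The page with the given entries is stored at address `A`. -/
def PageAt (disk : List Word) (A : ℕ) (recs : List Rec) : Prop :=
  diskAt disk A = .int recs.length ∧
    ∀ (i : ℕ) (h : i < recs.length), ∀ f < 10, diskAt disk (A + 1 + 10 * i + f) = (recs[i]).field f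

/-- `P` is the largest address to which a query may go on, or `0` if there is none. -/
def IsBest (recs : List Rec) (q : Point) (P : ℕ) : Prop :=
  (P = 0 ∨ ∃ rc ∈ recs, rc.Valid q ∧ rc.ptr = P) ∧ ∀ rc ∈ recs, rc.Valid q → rc.ptr ≤ P

/-- The query `q` goes in `d` steps from address `A` to address `L`. -/
inductive Walk (B W : ℕ) (disk : List Word) (q : Point) : ℕ → ℕ → ℕ → Prop
  | zero (A : ℕ) : Walk B W disk q 0 A A
  | succ (d A P L : ℕ) (recs : List Rec) (hA : PageAt disk A recs) (hB : recs.length ≤ 3 * B)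
      (hW : A + 10 * recs.length + 1 ≤ W) (hP : IsBest recs q P) (h : Walk B W disk q d P L) :
      Walk B W disk q (d + 1) A L

/-! ### The query program -/

/-- Read the word with the address in register `5` into register `out`, and advance register `5`.
The block with the number in register `4` is kept in the internal memory. -/
def fetchCmd (out : ℕ) : Cmd :=
  let load : Cmd := .seq (.read (.reg 9) (.lit 0)) (.assign 4 (.reg 9))
  .seq (.assign 9 (.op .div (.reg 5) (.reg 2)))
    (.seq (.ite (.reg 4) (.reg 9) load (.ite (.reg 9) (.reg 4) load .skip))
      (.seq (.assign out (.mem (.op .mod (.reg 5) (.reg 2))))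
        (.assign 5 (.op .add (.reg 5) (.lit 1)))))

/-- Read `k` consecutive words into the registers `out, out + 1, …`. -/
def fetchManyCmd (out : ℕ) : ℕ → Cmd
  | 0 => .skip
  | k + 1 => .seq (fetchManyCmd out k) (fetchCmd (out + k))

/-- Test whether the cut in the registers `k` and `k + 1` is before the query. -/
def cutCmd (k : ℕ) (yes no : Cmd) : Cmd :=
  .ite (.reg k) (.lit 2)
    (.ite (.reg k) (.lit 1) yes (.ite (.reg 0) (.reg (k + 1)) no yes))
    (.ite (.reg k) (.lit 3) (.ite (.reg (k + 1)) (.reg 0) yes no) no)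

/-- Test whether the segment in the registers `14` to `18`, if any, is above the query. -/
def aboveCmd (yes no : Cmd) : Cmd :=
  .ite (.reg 14) (.lit 1) yes
    (.ite (.reg 15) (.reg 17)
      (.ite (.op .mul (.op .sub (.reg 0) (.reg 15)) (.op .sub (.reg 18) (.reg 16)))
        (.op .mul (.op .sub (.reg 1) (.reg 16)) (.op .sub (.reg 17) (.reg 15))) no yes)
      (.ite (.reg 18) (.reg 1) no yes))

/-- Process the entry in the registers `10` to `19`. -/
def entryCmd : Cmd :=
  cutCmd 10 (cutCmd 12 .skip
    (aboveCmd (.ite (.reg 6) (.reg 19) (.assign 6 (.reg 19)) .skip) .skip)) .skip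

/-- Scan the entries of a page. -/
def scanCmd : Cmd :=
  .loop (.lit 0) (.reg 7)
    (.seq (fetchManyCmd 10 10) (.seq entryCmd (.assign 7 (.op .sub (.reg 7) (.lit 1)))))

/-- Follow the search path. -/
def walkCmd : Cmd :=
  .loop (.lit 0) (.reg 8)
    (.seq (.assign 5 (.reg 6)) (.seq (fetchCmd 7) (.seq (.assign 6 (.lit 0))
      (.seq scanCmd (.assign 8 (.op .sub (.reg 8) (.lit 1)))))))

/-- Disk words `2` and `3` hold the length of the search path and the address of its first page.
Register `6` holds the current address and then the best pointer, `7` the entries left on the page,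
`8` the steps left. The initial read makes the cache record in register `4` correct. -/
def queryCmd : Cmd :=
  .seq (.read (.lit 0) (.lit 0)) (.seq (.assign 4 (.lit 0)) (.seq (.assign 5 (.lit 2))
    (.seq (fetchCmd 8) (.seq (fetchCmd 6) (.seq walkCmd
      (.seq (.assign 5 (.reg 6)) (.seq (fetchCmd 0) (fetchCmd 1))))))))

/-! ### Correctness of the query program -/

theorem Word.ofInt_natCast {W a : ℕ} (h : a ≤ W) : Word.ofInt W (a : ℤ) = some (.int a) := by
  unfold Word.ofInt
  rw [if_pos]
  rw [abs_of_nonneg (by positivity)]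
  exact_mod_cast h

section Eval

variable {M W : ℕ} {s : State}

theorem Expr.eval_reg (i : ℕ) : (Expr.reg i).eval M W s = some (s.reg i) := rfl

theorem Expr.eval_lit {k : ℕ} (h : k ≤ W) : (Expr.lit k).eval M W s = some (.int k) :=
  Word.ofInt_natCast h

theorem Expr.eval_op {o : BinOp} {a b : Expr} {u v w : Word} (ha : a.eval M W s = some u)
    (hb : b.eval M W s = some v) (h : o.apply W u v = some w) :
    (Expr.op o a b).eval M W s = some w := by
  simp [Expr.eval, ha, hb, h]

theorem Expr.eval_mem {a : Expr} {k : ℕ} (ha : a.eval M W s = some (.int k)) (hk : k < M) :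
    (Expr.mem a).eval M W s = some (s.mem k) := by
  simp [Expr.eval, ha, hk]

theorem BinOp.apply_div {a b : ℕ} (hb : 0 < b) (ha : a ≤ W) :
    BinOp.div.apply W (.int a) (.int b) = some (.int ((a / b : ℕ) : ℤ)) := by
  have : (b : ℤ) ≠ 0 := by exact_mod_cast hb.ne'
  simp only [BinOp.apply, if_neg this]
  rw [← Int.natCast_div]
  exact Word.ofInt_natCast ((Nat.div_le_self _ _).trans ha)

theorem BinOp.apply_mod {a b : ℕ} (hb : 0 < b) (ha : a ≤ W) :
    BinOp.mod.apply W (.int a) (.int b) = some (.int ((a % b : ℕ) : ℤ)) := by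
  have : (b : ℤ) ≠ 0 := by exact_mod_cast hb.ne'
  simp only [BinOp.apply, if_neg this]
  rw [← Int.natCast_mod]
  exact Word.ofInt_natCast ((Nat.mod_le _ _).trans ha)

theorem BinOp.apply_add {a b : ℕ} (h : a + b ≤ W) :
    BinOp.add.apply W (.int a) (.int b) = some (.int ((a + b : ℕ) : ℤ)) := by
  simp only [BinOp.apply]
  rw [← Nat.cast_add]
  exact Word.ofInt_natCast h

theorem BinOp.apply_sub_one {a : ℕ} (h : a ≤ W) :
    BinOp.sub.apply W (.int ((a + 1 : ℕ) : ℤ)) (.int ((1 : ℕ) : ℤ)) = some (.int a) := by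
  simp only [BinOp.apply]
  rw [Nat.cast_add, Nat.cast_one, add_sub_cancel_right]
  exact Word.ofInt_natCast h

end Eval

section Exec

variable {B M W : ℕ} {disk : List Word}

theorem Exec.cast {c : Cmd} {s s' : State} {t t' : ℕ} (h : Exec B M W disk c s t s')
    (e : t = t') : Exec B M W disk c s t' s' := e ▸ h

theorem exec_ite_int {a b : Expr} {c d : Cmd} {s s' : State} {t : ℕ} {x y : ℤ}
    (ha : a.eval M W s = some (.int x)) (hb : b.eval M W s = some (.int y))
    (h1 : x < y → Exec B M W disk c s t s') (h2 : ¬ x < y → Exec B M W disk d s t s') :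
    Exec B M W disk (.ite a b c d) s t s' := by
  by_cases h : x < y
  · exact .ite_true a b c d s s' t _ _ _ ha hb rfl h (h1 h)
  · exact .ite_false a b c d s s' t _ _ _ ha hb rfl h (h2 h)

theorem exec_ite_real {a b : Expr} {c d : Cmd} {s s' : State} {t : ℕ} {x y : ℝ}
    (ha : a.eval M W s = some (.real x)) (hb : b.eval M W s = some (.real y))
    (h1 : x < y → Exec B M W disk c s t s') (h2 : ¬ x < y → Exec B M W disk d s t s') :
    Exec B M W disk (.ite a b c d) s t s' := by
  by_cases h : x < y
  · exact .ite_true a b c d s s' t _ _ _ ha hb rfl h (h1 h)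
  · exact .ite_false a b c d s s' t _ _ _ ha hb rfl h (h2 h)

theorem exec_loop_false {a b : Expr} {c : Cmd} {s : State} {x y : ℤ}
    (ha : a.eval M W s = some (.int x)) (hb : b.eval M W s = some (.int y)) (h : ¬ x < y) :
    Exec B M W disk (.loop a b c) s 0 s :=
  .loop_false a b c s _ _ _ ha hb rfl h

theorem exec_loop_true {a b : Expr} {c : Cmd} {s s' s'' : State} {t t' : ℕ} {x y : ℤ}
    (ha : a.eval M W s = some (.int x)) (hb : b.eval M W s = some (.int y)) (h : x < y)
    (hc : Exec B M W disk c s t s') (hl : Exec B M W disk (.loop a b c) s' t' s'') :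
    Exec B M W disk (.loop a b c) s (t + t') s'' :=
  .loop_true a b c s s' s'' t t' _ _ _ ha hb rfl h hc hl

/-- The internal memory holds block `κ` of the disk, as recorded in register `4`, and register `2`
holds the block size. -/
structure Cached (B : ℕ) (disk : List Word) (κ : ℕ) (s : State) : Prop where
  size : s.reg 2 = .int B
  blk : s.reg 4 = .int κ
  mem : ∀ j < B, s.mem j = diskAt disk (κ * B + j)

theorem State.reg_setReg (s : State) (i : ℕ) (v : Word) (j : ℕ) :
    (s.setReg i v).reg j = if j = i then v else s.reg j := by
  simp [State.setReg, Function.update_apply]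

theorem exec_fetch (hB : 0 < B) (hM : B ≤ M) {κ a out : ℕ} {s : State}
    (hc : Cached B disk κ s) (h5 : s.reg 5 = .int a) (hW : a + 1 ≤ W)
    (ho2 : out ≠ 2) (ho4 : out ≠ 4) (ho5 : out ≠ 5) :
    ∃ s', Exec B M W disk (fetchCmd out) s (if κ = a / B then 0 else 1) s' ∧
      Cached B disk (a / B) s' ∧ s'.reg 5 = .int ((a + 1 : ℕ) : ℤ) ∧
      s'.reg out = diskAt disk a ∧
      ∀ i, i ≠ 4 → i ≠ 5 → i ≠ 9 → i ≠ out → s'.reg i = s.reg i := by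
  set s₁ := s.setReg 9 (.int ((a / B : ℕ) : ℤ)) with hs₁
  have e1 : Exec B M W disk (.assign 9 (.op .div (.reg 5) (.reg 2))) s 0 s₁ := by
    refine .assign _ _ _ _ (Expr.eval_op (Expr.eval_reg 5) (Expr.eval_reg 2) ?_)
    rw [h5, hc.size]
    exact BinOp.apply_div hB (by omega)
  obtain ⟨s₂, e2, hc2, h52, hr2⟩ : ∃ s₂, Exec B M W disk (.ite (.reg 4) (.reg 9)
      (.seq (.read (.reg 9) (.lit 0)) (.assign 4 (.reg 9)))
      (.ite (.reg 9) (.reg 4) (.seq (.read (.reg 9) (.lit 0)) (.assign 4 (.reg 9))) .skip)) s₁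
      (if κ = a / B then 0 else 1) s₂ ∧ Cached B disk (a / B) s₂ ∧ s₂.reg 5 = .int a ∧
      ∀ i, i ≠ 4 → i ≠ 9 → s₂.reg i = s.reg i := by
    have h4 : s₁.reg 4 = .int κ := by rw [hs₁, State.reg_setReg, if_neg (by decide), hc.blk]
    have h9 : s₁.reg 9 = .int ((a / B : ℕ) : ℤ) := by rw [hs₁, State.reg_setReg, if_pos rfl]
    by_cases hκ : κ = a / B
    · refine ⟨s₁, ?_, ⟨?_, hκ ▸ h4, ?_⟩, ?_, ?_⟩
      · rw [if_pos hκ]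
        refine exec_ite_int (by rw [Expr.eval_reg, h4]) (by rw [Expr.eval_reg, h9])
          (fun h => absurd h (by rw [hκ]; exact lt_irrefl _)) fun _ => ?_
        exact exec_ite_int (by rw [Expr.eval_reg, h9]) (by rw [Expr.eval_reg, h4])
          (fun h => absurd h (by rw [hκ]; exact lt_irrefl _)) fun _ => .skip _
      · rw [hs₁, State.reg_setReg, if_neg (by decide), hc.size]
      · rw [← hκ]; exact hc.mem
      · rw [hs₁, State.reg_setReg, if_neg (by decide), h5]
      · intro i _ h9
        rw [hs₁, State.reg_setReg, if_neg h9]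
    · set s₂ := (s₁.load B disk (a / B) 0).setReg 4 (.int ((a / B : ℕ) : ℤ)) with hs₂
      have hl : Exec B M W disk (.seq (.read (.reg 9) (.lit 0)) (.assign 4 (.reg 9))) s₁ 1 s₂ := by
        refine .seq _ _ _ _ _ 1 0 (.read _ _ _ (a / B) 0 ?_ ?_ (by omega)) (.assign _ _ _ _ ?_)
        · rw [Expr.eval_reg, h9]
        · exact Expr.eval_lit (Nat.zero_le _)
        · rw [Expr.eval_reg]
          exact congrArg some h9
      refine ⟨s₂, ?_, ⟨?_, ?_, ?_⟩, ?_, ?_⟩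
      · rw [if_neg hκ]
        refine exec_ite_int (by rw [Expr.eval_reg, h4]) (by rw [Expr.eval_reg, h9])
          (fun _ => hl) fun h => ?_
        refine exec_ite_int (by rw [Expr.eval_reg, h9]) (by rw [Expr.eval_reg, h4])
          (fun _ => hl) fun h' => absurd (le_antisymm (not_lt.1 h') (not_lt.1 h)) ?_
        exact_mod_cast hκ
      · rw [hs₂, State.reg_setReg, if_neg (by decide)]
        change s₁.reg 2 = _
        rw [hs₁, State.reg_setReg, if_neg (by decide), hc.size]
      · rw [hs₂, State.reg_setReg, if_pos rfl]
      · intro j hj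
        simp [hs₂, State.setReg, State.load, hj, diskAt]
      · rw [hs₂, State.reg_setReg, if_neg (by decide)]
        change s₁.reg 5 = _
        rw [hs₁, State.reg_setReg, if_neg (by decide), h5]
      · intro i h4 h9
        rw [hs₂, State.reg_setReg, if_neg h4]
        change s₁.reg i = _
        rw [hs₁, State.reg_setReg, if_neg h9]
  have hval : s₂.mem (a % B) = diskAt disk a := by
    rw [hc2.mem _ (Nat.mod_lt _ hB), Nat.mul_comm, Nat.div_add_mod]
  set s₃ := s₂.setReg out (diskAt disk a) with hs₃
  have e3 : Exec B M W disk (.assign out (.mem (.op .mod (.reg 5) (.reg 2)))) s₂ 0 s₃ := by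
    refine .assign _ _ _ _ ?_
    rw [← hval]
    refine Expr.eval_mem (Expr.eval_op (Expr.eval_reg 5) (Expr.eval_reg 2) ?_)
      ((Nat.mod_lt _ hB).trans_le hM)
    rw [h52, hc2.size]
    exact BinOp.apply_mod hB (by omega)
  set s₄ := s₃.setReg 5 (.int ((a + 1 : ℕ) : ℤ)) with hs₄
  have h53 : s₃.reg 5 = .int a := by rw [hs₃, State.reg_setReg, if_neg (Ne.symm ho5), h52]
  have e4 : Exec B M W disk (.assign 5 (.op .add (.reg 5) (.lit 1))) s₃ 0 s₄ := by
    refine .assign _ _ _ _ (Expr.eval_op (Expr.eval_reg 5)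
      (Expr.eval_lit (k := 1) (by omega)) ?_)
    rw [h53]
    exact BinOp.apply_add hW
  refine ⟨s₄, (Exec.seq _ _ _ _ _ _ _ e1 (.seq _ _ _ _ _ _ _ e2
    (.seq _ _ _ _ _ _ _ e3 e4))).cast (by simp), ⟨?_, ?_, ?_⟩, ?_, ?_, ?_⟩
  · rw [hs₄, State.reg_setReg, if_neg (by decide), hs₃, State.reg_setReg, if_neg (Ne.symm ho2),
      hc2.size]
  · rw [hs₄, State.reg_setReg, if_neg (by decide), hs₃, State.reg_setReg, if_neg (Ne.symm ho4),
      hc2.blk]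
  · exact hc2.mem
  · rw [hs₄, State.reg_setReg, if_pos rfl]
  · rw [hs₄, State.reg_setReg, if_neg ho5, hs₃, State.reg_setReg, if_pos rfl]
  · intro i h4 h5 h9 ho
    rw [hs₄, State.reg_setReg, if_neg h5, hs₃, State.reg_setReg, if_neg ho, hr2 i h4 h9]

/-- Only crossing a block boundary costs a transfer, so the cost is a difference of block numbers.
Such differences telescope when runs of consecutive words are concatenated. -/
theorem exec_fetchMany (hB : 0 < B) (hM : B ≤ M) {a out : ℕ} (hout : 9 < out) {s : State}
    (hc : Cached B disk (a / B) s) (h5 : s.reg 5 = .int ((a + 1 : ℕ) : ℤ)) (k : ℕ)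
    (hW : a + k + 1 ≤ W) :
    ∃ s', Exec B M W disk (fetchManyCmd out k) s ((a + k) / B - a / B) s' ∧
      Cached B disk ((a + k) / B) s' ∧ s'.reg 5 = .int ((a + k + 1 : ℕ) : ℤ) ∧
      (∀ f < k, s'.reg (out + f) = diskAt disk (a + 1 + f)) ∧
      ∀ i ≤ 9, i ≠ 4 → i ≠ 5 → i ≠ 9 → s'.reg i = s.reg i := by
  induction k with
  | zero => exact ⟨s, (Exec.skip s).cast (by simp), hc, h5, by simp, fun _ _ _ _ _ => rfl⟩
  | succ k ih =>
    obtain ⟨s₁, e1, hc1, h51, hf1, hr1⟩ := ih (by omega)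
    obtain ⟨s₂, e2, hc2, h52, ho2, hr2⟩ := exec_fetch (a := a + k + 1) (out := out + k) hB hM hc1
      h51 (by omega) (by omega) (by omega) (by omega)
    refine ⟨s₂, (Exec.seq _ _ _ _ _ _ _ e1 e2).cast ?_, hc2, h52, ?_, ?_⟩
    · have h1 : a / B ≤ (a + k) / B := Nat.div_le_div_right (by omega)
      have h2 : (a + k) / B ≤ (a + k + 1) / B := Nat.div_le_div_right (by omega)
      have h3 : (a + k + 1) / B ≤ (a + k) / B + 1 := by
        rw [← Nat.add_div_right _ hB]
        exact Nat.div_le_div_right (by omega)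
      rw [← Nat.add_assoc a k 1]
      split_ifs with h <;> omega
    · intro f hf
      rcases Nat.lt_succ_iff_lt_or_eq.1 hf with h | rfl
      · rw [hr2 _ (by omega) (by omega) (by omega) (by omega), hf1 f h]
      · rw [ho2]
        congr 1
        omega
    · intro i hi h4 h5 h9
      rw [hr2 i h4 h5 h9 (by omega), hr1 i hi h4 h5 h9]

theorem exec_cut (hW : 3 ≤ W) {k : ℕ} {yes no : Cmd} {s s' : State} {t : ℕ} {κ : Cut} {x : ℝ}
    (h0 : s.reg 0 = .real x) (hk : s.reg k = .int κ.kind) (hv : s.reg (k + 1) = κ.word)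
    (hy : κ.Before x → Exec B M W disk yes s t s')
    (hn : ¬ κ.Before x → Exec B M W disk no s t s') :
    Exec B M W disk (cutCmd k yes no) s t s' := by
  have l1 := Expr.eval_lit (M := M) (s := s) (show 1 ≤ W by omega)
  have l2 := Expr.eval_lit (M := M) (s := s) (show 2 ≤ W by omega)
  have l3 := Expr.eval_lit (M := M) (s := s) hW
  have hr : (Expr.reg k).eval M W s = some (.int κ.kind) := by rw [Expr.eval_reg, hk]
  have hx : (Expr.reg 0).eval M W s = some (.real x) := by rw [Expr.eval_reg, h0]
  have hw : (Expr.reg (k + 1)).eval M W s = some κ.word := by rw [Expr.eval_reg, hv]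
  cases κ with
  | always =>
    refine exec_ite_int hr l2 (fun _ => ?_) (fun h => absurd h (by simp [Cut.kind]))
    exact exec_ite_int hr l1 (fun _ => hy trivial) (fun h => absurd h (by simp [Cut.kind]))
  | ins a =>
    refine exec_ite_int hr l2 (fun _ => ?_) (fun h => absurd h (by simp [Cut.kind]))
    refine exec_ite_int hr l1 (fun h => absurd h (by simp [Cut.kind])) (fun _ => ?_)
    exact exec_ite_real hx hw (fun h => hn (not_le.2 h)) (fun h => hy (not_lt.1 h))
  | del a =>
    refine exec_ite_int hr l2 (fun h => absurd h (by simp [Cut.kind])) (fun _ => ?_)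
    refine exec_ite_int hr l3 (fun _ => ?_) (fun h => absurd h (by simp [Cut.kind]))
    exact exec_ite_real hw hx (fun h => hy h) (fun h => hn h)
  | never =>
    refine exec_ite_int hr l2 (fun h => absurd h (by simp [Cut.kind])) (fun _ => ?_)
    exact exec_ite_int hr l3 (fun h => absurd h (by simp [Cut.kind])) (fun _ => hn id)

theorem exec_above (hW : 1 ≤ W) {yes no : Cmd} {s s' : State} {t : ℕ} {rc : Rec} {q : Point}
    (h0 : s.reg 0 = .real q.1) (h1 : s.reg 1 = .real q.2)
    (hf : ∀ f < 10, s.reg (10 + f) = rc.field f)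
    (hy : (∀ σ ∈ rc.seg, σ.Above q) → Exec B M W disk yes s t s')
    (hn : ¬ (∀ σ ∈ rc.seg, σ.Above q) → Exec B M W disk no s t s') :
    Exec B M W disk (aboveCmd yes no) s t s' := by
  have l1 := Expr.eval_lit (M := M) (s := s) hW
  have f4 : (Expr.reg 14).eval M W s = some (rc.field 4) := congrArg some (hf 4 (by omega))
  have f5 : (Expr.reg 15).eval M W s = some (rc.field 5) := congrArg some (hf 5 (by omega))
  have f6 : (Expr.reg 16).eval M W s = some (rc.field 6) := congrArg some (hf 6 (by omega))
  have f7 : (Expr.reg 17).eval M W s = some (rc.field 7) := congrArg some (hf 7 (by omega))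
  have f8 : (Expr.reg 18).eval M W s = some (rc.field 8) := congrArg some (hf 8 (by omega))
  have hx : (Expr.reg 0).eval M W s = some (.real q.1) := by rw [Expr.eval_reg, h0]
  have hz : (Expr.reg 1).eval M W s = some (.real q.2) := by rw [Expr.eval_reg, h1]
  rcases hs : rc.seg with _ | σ
  · rw [hs] at hy
    simp only [Rec.field, hs, Option.elim] at f4
    exact exec_ite_int f4 l1 (fun _ => hy (by simp)) (fun h => absurd h (by simp))
  · simp only [Rec.field, hs, Option.elim] at f4 f5 f6 f7 f8
    have hiff : (∀ σ' ∈ rc.seg, σ'.Above q) ↔ σ.Above q := by simp [hs]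
    rw [hiff] at hy hn
    refine exec_ite_int f4 l1 (fun h => absurd h (by simp)) (fun _ => ?_)
    refine exec_ite_real f5 f7 (fun hlt => ?_) (fun hlt => ?_)
    · refine exec_ite_real (Expr.eval_op (Expr.eval_op hx f5 rfl) (Expr.eval_op f8 f6 rfl) rfl)
        (Expr.eval_op (Expr.eval_op hz f6 rfl) (Expr.eval_op f7 f5 rfl) rfl)
        (fun h => hn fun hA => ?_) (fun h => hy ⟨fun _ => not_lt.1 h, fun h' => absurd hlt h'⟩)
      exact absurd h (not_lt.2 (hA.1 hlt))
    · refine exec_ite_real f8 hz (fun h => hn fun hA => ?_)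
        (fun h => hy ⟨fun h' => absurd h' hlt, fun _ => not_lt.1 h⟩)
      exact absurd h (not_lt.2 (hA.2 hlt))

theorem exec_entry (hW : 3 ≤ W) {s : State} {rc : Rec} {q : Point} {b : ℕ}
    (h0 : s.reg 0 = .real q.1) (h1 : s.reg 1 = .real q.2) (h6 : s.reg 6 = .int b)
    (hf : ∀ f < 10, s.reg (10 + f) = rc.field f) :
    ∃ P : ℕ, Exec B M W disk entryCmd s 0 (s.setReg 6 (.int P)) ∧ b ≤ P ∧
      (P = b ∨ (rc.Valid q ∧ rc.ptr = P)) ∧ (rc.Valid q → rc.ptr ≤ P) := by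
  have hself : s.setReg 6 (.int b) = s := by
    rw [← h6]
    simp [State.setReg]
  have hcut1 := fun yes no P => exec_cut (B := B) (M := M) (disk := disk) (k := 10) (yes := yes)
    (no := no) (s' := s.setReg 6 (.int P)) (t := 0) hW h0 (hf 0 (by omega)) (hf 1 (by omega))
  have hcut2 := fun yes no P => exec_cut (B := B) (M := M) (disk := disk) (k := 12) (yes := yes)
    (no := no) (s' := s.setReg 6 (.int P)) (t := 0) hW h0 (hf 2 (by omega)) (hf 3 (by omega))
  have habove := fun yes no P => exec_above (B := B) (M := M) (W := W) (disk := disk) (yes := yes)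
    (no := no) (s' := s.setReg 6 (.int P)) (t := 0) (by omega) h0 h1 hf
  by_cases hv : rc.Valid q
  · refine ⟨max b rc.ptr, ?_, le_max_left _ _, ?_, fun _ => le_max_right _ _⟩
    · refine hcut1 _ _ _ (fun _ => ?_) (fun h => absurd hv.1 h)
      refine hcut2 _ _ _ (fun h => absurd h hv.2.1) (fun _ => ?_)
      refine habove _ _ _ (fun _ => ?_) (fun h => absurd hv.2.2 h)
      have e6 : (Expr.reg 6).eval M W s = some (.int b) := congrArg some h6
      have e9 : (Expr.reg 19).eval M W s = some (.int rc.ptr) := congrArg some (hf 9 (by omega))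
      refine exec_ite_int e6 e9 (fun h => ?_) (fun h => ?_)
      · have : b ≤ rc.ptr := by exact_mod_cast h.le
        rw [max_eq_right this]
        exact .assign _ _ _ _ e9
      · have : rc.ptr ≤ b := by exact_mod_cast not_lt.1 h
        rw [max_eq_left this, hself]
        exact .skip s
    · rcases le_total b rc.ptr with h | h
      · exact Or.inr ⟨hv, (max_eq_right h).symm⟩
      · exact Or.inl (max_eq_left h)
  · refine ⟨b, ?_, le_rfl, Or.inl rfl, fun h => absurd h hv⟩
    have hskip : Exec B M W disk .skip s 0 (s.setReg 6 (.int b)) := by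
      rw [hself]
      exact .skip s
    refine hcut1 _ _ _ (fun c1 => ?_) (fun _ => hskip)
    refine hcut2 _ _ _ (fun _ => hskip) (fun c2 => ?_)
    exact habove _ _ _ (fun c3 => absurd ⟨c1, c2, c3⟩ hv) (fun _ => hskip)

/-- The starting value `b` of the running maximum is arbitrary for the sake of the induction over
the entries. -/
theorem exec_scan (hB : 0 < B) (hM : B ≤ M) (hW3 : 3 ≤ W) {q : Point} (recs : List Rec) :
    ∀ {a b : ℕ} {s : State}, Cached B disk (a / B) s → s.reg 5 = .int ((a + 1 : ℕ) : ℤ) →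
      s.reg 0 = .real q.1 → s.reg 1 = .real q.2 → s.reg 6 = .int b →
      s.reg 7 = .int recs.length →
      (∀ (i : ℕ) (h : i < recs.length), ∀ f < 10,
        diskAt disk (a + 1 + 10 * i + f) = (recs[i]).field f) →
      a + 10 * recs.length + 1 ≤ W →
      ∃ (P : ℕ) (s' : State),
        Exec B M W disk scanCmd s ((a + 10 * recs.length) / B - a / B) s' ∧
        Cached B disk ((a + 10 * recs.length) / B) s' ∧
        s'.reg 0 = .real q.1 ∧ s'.reg 1 = .real q.2 ∧ s'.reg 6 = .int P ∧
        s'.reg 8 = s.reg 8 ∧ b ≤ P ∧ (P = b ∨ ∃ rc ∈ recs, rc.Valid q ∧ rc.ptr = P) ∧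
        ∀ rc ∈ recs, rc.Valid q → rc.ptr ≤ P := by
  have l0 : ∀ s, (Expr.lit 0).eval M W s = some (.int ((0 : ℕ) : ℤ)) := fun s =>
    Expr.eval_lit (Nat.zero_le _)
  induction recs with
  | nil =>
    intro a b s hc h5 h0 h1 h6 h7 hd hW
    refine ⟨b, s, (exec_loop_false (l0 s) (by rw [Expr.eval_reg, h7]) (by simp)).cast (by simp),
      by simpa using hc, h0, h1, h6, rfl, le_rfl, Or.inl rfl, by simp⟩
  | cons rc recs ih =>
    intro a b s hc h5 h0 h1 h6 h7 hd hW
    rw [List.length_cons] at h7 hW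
    obtain ⟨s₁, e1, hc1, h51, hf1, hr1⟩ := exec_fetchMany (W := W) hB hM (out := 10) (by omega) hc h5 10
      (by omega)
    have hf : ∀ f < 10, s₁.reg (10 + f) = rc.field f := by
      intro f hlt
      rw [hf1 f hlt]
      exact hd 0 (by simp) f hlt
    obtain ⟨P₁, e2, hP1, hP2, hP3⟩ := exec_entry (B := B) (M := M) (disk := disk) hW3
      ((hr1 0 (by omega) (by omega) (by omega) (by omega)).trans h0)
      ((hr1 1 (by omega) (by omega) (by omega) (by omega)).trans h1)
      ((hr1 6 (by omega) (by omega) (by omega) (by omega)).trans h6) hf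
    set s₂ := s₁.setReg 6 (.int P₁) with hs₂
    set s₃ := s₂.setReg 7 (.int recs.length) with hs₃
    have e3 : Exec B M W disk (.assign 7 (.op .sub (.reg 7) (.lit 1))) s₂ 0 s₃ := by
      refine .assign _ _ _ _ (Expr.eval_op (Expr.eval_reg 7)
        (Expr.eval_lit (k := 1) (by omega)) ?_)
      rw [hs₂, State.reg_setReg, if_neg (by decide), hr1 7 (by omega) (by omega) (by omega)
        (by omega), h7]
      exact BinOp.apply_sub_one (by omega)
    have hr3 : ∀ i, i ≠ 6 → i ≠ 7 → s₃.reg i = s₁.reg i := by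
      intro i h6 h7
      rw [hs₃, State.reg_setReg, if_neg h7, hs₂, State.reg_setReg, if_neg h6]
    obtain ⟨P, s', e4, hc4, h04, h14, h64, h84, hP4, hP5, hP6⟩ := ih (a := a + 10) (b := P₁)
      (s := s₃)
      ⟨(hr3 2 (by omega) (by omega)).trans hc1.size, (hr3 4 (by omega) (by omega)).trans hc1.blk,
        hc1.mem⟩
      ((hr3 5 (by omega) (by omega)).trans h51)
      ((hr3 0 (by omega) (by omega)).trans
        ((hr1 0 (by omega) (by omega) (by omega) (by omega)).trans h0))
      ((hr3 1 (by omega) (by omega)).trans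
        ((hr1 1 (by omega) (by omega) (by omega) (by omega)).trans h1))
      (by rw [hs₃, State.reg_setReg, if_neg (by decide), hs₂, State.reg_setReg, if_pos rfl])
      (by rw [hs₃, State.reg_setReg, if_pos rfl])
      (by
        intro i h f hlt
        have := hd (i + 1) (by simpa using h) f hlt
        rw [List.getElem_cons_succ] at this
        rw [← this]
        congr 1
        omega)
      (by omega)
    have hlen : a + 10 + 10 * recs.length = a + 10 * (recs.length + 1) := by ring
    rw [hlen] at e4 hc4
    refine ⟨P, s', ?_, hc4, h04, h14, h64, ?_, hP1.trans hP4, ?_, ?_⟩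
    · refine (exec_loop_true (t := (a + 10) / B - a / B) (l0 s) (by rw [Expr.eval_reg, h7])
        (by exact_mod_cast Nat.succ_pos _)
        ((Exec.seq _ _ _ _ _ _ _ e1 (.seq _ _ _ _ _ _ _ e2 e3)).cast (by simp)) e4).cast ?_
      rw [List.length_cons]
      have h1 : a / B ≤ (a + 10) / B := Nat.div_le_div_right (by omega)
      have h2 : (a + 10) / B ≤ (a + 10 * (recs.length + 1)) / B := Nat.div_le_div_right (by omega)
      omega
    · rw [h84, hr3 8 (by omega) (by omega), hr1 8 (by omega) (by omega) (by omega) (by omega)]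
    · rcases hP5 with rfl | ⟨rc', hm, hv⟩
      · rcases hP2 with rfl | h
        · exact Or.inl rfl
        · exact Or.inr ⟨rc, by simp, h⟩
      · exact Or.inr ⟨rc', by simp [hm], hv⟩
    · intro rc' hm hv
      rcases List.mem_cons.1 hm with rfl | hm
      · exact (hP3 hv).trans hP4
      · exact hP6 rc' hm hv

/-- A step costs at most `31` transfers: one for the length word of the page, and `30` for at most
`3 * B` entries of ten words each. -/
theorem exec_walk (hB : 0 < B) (hM : B ≤ M) (hW3 : 3 ≤ W) {q : Point} {d A L : ℕ}
    (hwalk : Walk B W disk q d A L) :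
    ∀ {κ : ℕ} {s : State}, Cached B disk κ s → s.reg 0 = .real q.1 → s.reg 1 = .real q.2 →
      s.reg 6 = .int A → s.reg 8 = .int d → d ≤ W →
      ∃ (t κ' : ℕ) (s' : State), Exec B M W disk walkCmd s t s' ∧ t ≤ 31 * d ∧
        Cached B disk κ' s' ∧ s'.reg 6 = .int L := by
  have l0 : ∀ s, (Expr.lit 0).eval M W s = some (.int ((0 : ℕ) : ℤ)) := fun s =>
    Expr.eval_lit (Nat.zero_le _)
  induction hwalk with
  | zero A =>
    intro κ s hc h0 h1 h6 h8 hd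
    exact ⟨0, κ, s, exec_loop_false (l0 s) (by rw [Expr.eval_reg, h8]) (lt_irrefl _), by simp, hc, h6⟩
  | succ d A P L recs hA hlen hW hP _ ih =>
    intro κ s hc h0 h1 h6 h8 hd
    set s₁ := s.setReg 5 (.int A) with hs₁
    have e1 : Exec B M W disk (.assign 5 (.reg 6)) s 0 s₁ :=
      .assign _ _ _ _ (by rw [Expr.eval_reg, h6])
    have hr1 : ∀ i, i ≠ 5 → s₁.reg i = s.reg i := fun i hi => by
      rw [hs₁, State.reg_setReg, if_neg hi]
    obtain ⟨s₂, e2, hc2, h52, h72, hr2⟩ := exec_fetch (s := s₁) (a := A) (out := 7) (W := W) hB hM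
      ⟨(hr1 2 (by omega)).trans hc.size, (hr1 4 (by omega)).trans hc.blk, hc.mem⟩
      (by rw [hs₁, State.reg_setReg, if_pos rfl]) (by omega) (by omega) (by omega) (by omega)
    set s₃ := s₂.setReg 6 (.int ((0 : ℕ) : ℤ)) with hs₃
    have e3 : Exec B M W disk (.assign 6 (.lit 0)) s₂ 0 s₃ := .assign _ _ _ _ (l0 _)
    have hr3 : ∀ i, i ≠ 6 → s₃.reg i = s₂.reg i := fun i hi => by
      rw [hs₃, State.reg_setReg, if_neg hi]
    have hr : ∀ i ∉ ({4, 5, 6, 7, 9} : Finset ℕ), s₃.reg i = s.reg i := by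
      intro i hi
      simp only [Finset.mem_insert, Finset.mem_singleton, not_or] at hi
      rw [hr3 i (by tauto), hr2 i (by tauto) (by tauto) (by tauto) (by tauto), hr1 i (by tauto)]
    obtain ⟨P', s₄, e4, hc4, h04, h14, h64, h84, -, hP1, hP2⟩ := exec_scan hB hM hW3 (q := q) recs
      (s := s₃) (a := A) (b := 0)
      ⟨(hr3 2 (by omega)).trans hc2.size, (hr3 4 (by omega)).trans hc2.blk, hc2.mem⟩
      ((hr3 5 (by omega)).trans h52) ((hr 0 (by decide)).trans h0) ((hr 1 (by decide)).trans h1)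
      (by rw [hs₃, State.reg_setReg, if_pos rfl])
      (by rw [hr3 7 (by omega), h72, hA.1]) hA.2 hW
    -- The scan and `IsBest` describe the same maximum, with `0` for no valid entry.
    obtain rfl : P' = P := by
      rcases hP1 with h | ⟨rc, hm, hv, h⟩ <;> rcases hP.1 with h' | ⟨rc', hm', hv', h'⟩
      · omega
      · have := hP2 rc' hm' hv'
        omega
      · have := hP.2 rc hm hv
        omega
      · have := hP2 rc' hm' hv'
        have := hP.2 rc hm hv
        omega
    set s₅ := s₄.setReg 8 (.int d) with hs₅
    have e5 : Exec B M W disk (.assign 8 (.op .sub (.reg 8) (.lit 1))) s₄ 0 s₅ := by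
      refine .assign _ _ _ _ (Expr.eval_op (Expr.eval_reg 8)
        (Expr.eval_lit (k := 1) (by omega)) ?_)
      rw [h84, hr 8 (by decide), h8]
      exact BinOp.apply_sub_one (by omega)
    have hr5 : ∀ i, i ≠ 8 → s₅.reg i = s₄.reg i := fun i hi => by
      rw [hs₅, State.reg_setReg, if_neg hi]
    obtain ⟨t, κ', s', e6, ht, hc6, h66⟩ := ih (s := s₅)
      ⟨(hr5 2 (by omega)).trans hc4.size, (hr5 4 (by omega)).trans hc4.blk, hc4.mem⟩
      ((hr5 0 (by omega)).trans h04) ((hr5 1 (by omega)).trans h14)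
      ((hr5 6 (by omega)).trans h64) (by rw [hs₅, State.reg_setReg, if_pos rfl]) (by omega)
    refine ⟨_, κ', s', exec_loop_true (l0 s) (by rw [Expr.eval_reg, h8])
      (by exact_mod_cast Nat.succ_pos _)
      (.seq _ _ _ _ _ _ _ e1 (.seq _ _ _ _ _ _ _ e2 (.seq _ _ _ _ _ _ _ e3
        (.seq _ _ _ _ _ _ _ e4 e5)))) e6, ?_, hc6, h66⟩
    have h1 : (A + 10 * recs.length) / B ≤ A / B + 30 := by
      have : (A + 10 * recs.length) / B ≤ (A + 30 * B) / B := Nat.div_le_div_right (by omega)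
      rwa [Nat.add_mul_div_right _ _ hB] at this
    split_ifs <;> omega

/-- The query program follows the search path and returns the two words at its end. -/
theorem exec_query (hB : 0 < B) (hM : B ≤ M) (hW : 4 ≤ W) {n : ℕ} {q : Point} {d A L : ℕ}
    (hd : diskAt disk 2 = .int d) (hA : diskAt disk 3 = .int A) (hdW : d ≤ W) (hLW : L + 2 ≤ W)
    (hwalk : Walk B W disk q d A L) :
    ∃ (t : ℕ) (s : State), Exec B M W disk queryCmd (queryState B n q) t s ∧ t ≤ 31 * d + 5 ∧
      s.reg 0 = diskAt disk L ∧ s.reg 1 = diskAt disk (L + 1) := by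
  have l0 : ∀ s, (Expr.lit 0).eval M W s = some (.int ((0 : ℕ) : ℤ)) := fun s =>
    Expr.eval_lit (Nat.zero_le _)
  set s₀ := queryState B n q with hs₀
  set s₁ := s₀.load B disk 0 0 with hs₁
  have e1 : Exec B M W disk (.read (.lit 0) (.lit 0)) s₀ 1 s₁ :=
    .read _ _ _ 0 0 (l0 _) (l0 _) (by omega)
  set s₂ := s₁.setReg 4 (.int ((0 : ℕ) : ℤ)) with hs₂
  have e2 : Exec B M W disk (.assign 4 (.lit 0)) s₁ 0 s₂ := .assign _ _ _ _ (l0 _)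
  set s₃ := s₂.setReg 5 (.int ((2 : ℕ) : ℤ)) with hs₃
  have e3 : Exec B M W disk (.assign 5 (.lit 2)) s₂ 0 s₃ :=
    .assign _ _ _ _ (Expr.eval_lit (k := 2) (by omega))
  have hr3 : ∀ i, i ≠ 4 → i ≠ 5 → s₃.reg i = s₀.reg i := by
    intro i h4 h5
    rw [hs₃, State.reg_setReg, if_neg h5, hs₂, State.reg_setReg, if_neg h4]
    rfl
  have hc3 : Cached B disk 0 s₃ := by
    refine ⟨by rw [hr3 2 (by omega) (by omega)]; rfl, ?_, ?_⟩
    · rw [hs₃, State.reg_setReg, if_neg (by decide), hs₂, State.reg_setReg, if_pos rfl]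
    · intro j hj
      simp [hs₃, hs₂, hs₁, State.setReg, State.load, hj, diskAt]
  obtain ⟨s₄, e4, hc4, h54, h84, hr4⟩ := exec_fetch (a := 2) (out := 8) (W := W) hB hM hc3
    (by rw [hs₃, State.reg_setReg, if_pos rfl]) (by omega) (by omega) (by omega) (by omega)
  obtain ⟨s₅, e5, hc5, h55, h65, hr5⟩ := exec_fetch (a := 3) (out := 6) (W := W) hB hM hc4
    h54 (by omega) (by omega) (by omega) (by omega)
  obtain ⟨t, κ, s₆, e6, ht, hc6, h66⟩ := exec_walk hB hM (by omega) hwalk hc5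
    (by rw [hr5 0 (by omega) (by omega) (by omega) (by omega),
          hr4 0 (by omega) (by omega) (by omega) (by omega), hr3 0 (by omega) (by omega)]; rfl)
    (by rw [hr5 1 (by omega) (by omega) (by omega) (by omega),
          hr4 1 (by omega) (by omega) (by omega) (by omega), hr3 1 (by omega) (by omega)]; rfl)
    (h65.trans hA)
    (by rw [hr5 8 (by omega) (by omega) (by omega) (by omega), h84, hd]) hdW
  set s₇ := s₆.setReg 5 (.int L) with hs₇
  have e7 : Exec B M W disk (.assign 5 (.reg 6)) s₆ 0 s₇ :=
    .assign _ _ _ _ (by rw [Expr.eval_reg, h66])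
  have hr7 : ∀ i, i ≠ 5 → s₇.reg i = s₆.reg i := fun i hi => by
    rw [hs₇, State.reg_setReg, if_neg hi]
  obtain ⟨s₈, e8, hc8, h58, h08, hr8⟩ := exec_fetch (s := s₇) (a := L) (out := 0) (W := W) hB hM
    ⟨(hr7 2 (by omega)).trans hc6.size, (hr7 4 (by omega)).trans hc6.blk, hc6.mem⟩
    (by rw [hs₇, State.reg_setReg, if_pos rfl]) (by omega) (by omega) (by omega) (by omega)
  obtain ⟨s₉, e9, hc9, h59, h19, hr9⟩ := exec_fetch (a := L + 1) (out := 1) (W := W) hB hM hc8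
    h58 (by omega) (by omega) (by omega) (by omega)
  refine ⟨_, s₉, .seq _ _ _ _ _ _ _ e1 (.seq _ _ _ _ _ _ _ e2 (.seq _ _ _ _ _ _ _ e3
    (.seq _ _ _ _ _ _ _ e4 (.seq _ _ _ _ _ _ _ e5 (.seq _ _ _ _ _ _ _ e6
      (.seq _ _ _ _ _ _ _ e7 (.seq _ _ _ _ _ _ _ e8 e9))))))), ?_, ?_, h19⟩
  -- The additional `5` transfers are the initial read and at most one for each of the two header
  -- words and the two answer words.
  · split_ifs <;> omega
  · rw [hr9 0 (by omega) (by omega) (by omega) (by omega), h08]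

end Exec


/-! ### Ranks of endpoints and cuts -/

section Ranks

variable {n : ℕ}

/-- The cut at which a segment starts (`false`) or ends (`true`) to meet vertical lines. -/
noncomputable def endCut (T : Fin n → Seg) (z : Fin n × Bool) : Cut :=
  if z.2 then .del (T z.1).norm.q.1 else .ins (T z.1).norm.p.1

theorem endCut_before_mono {T : Fin n → Seg} {z : Fin n × Bool} {x y : ℝ} (h : x ≤ y)
    (hx : (endCut T z).Before x) : (endCut T z).Before y := by
  unfold endCut at *
  split_ifs at * <;> simp only [Cut.Before] at * <;> linarith

/-- `ev` and `ρ` rank the endpoints and the vertical lines from left to right. -/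
def IsRanking (T : Fin n → Seg) (ev : Fin n × Bool → ℕ) (ρ : ℝ → ℕ) : Prop :=
  (∀ z x, ev z < ρ x ↔ (endCut T z).Before x) ∧ ∀ x, ρ x ≤ 2 * n

/-- The lines to the right of a cut form an up-closed set, so the cuts are linearly ordered. `ρ x`
counts the ends before `x`, and `ev z` the ends strictly before `z`, meaning that some line
separates them; coinciding cuts get the same rank. -/
theorem exists_isRanking (T : Fin n → Seg) : ∃ ev ρ, IsRanking T ev ρ := by
  classical
  refine ⟨fun z => (Finset.univ.filter fun z' => ∃ x, (endCut T z').Before x ∧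
    ¬ (endCut T z).Before x).card,
    fun x => (Finset.univ.filter fun z => (endCut T z).Before x).card, ?_, ?_⟩
  · intro z x
    constructor
    · intro h
      by_contra hz
      refine absurd h (not_lt.2 (Finset.card_le_card fun z' hz' => ?_))
      simp only [Finset.mem_filter, Finset.mem_univ, true_and] at hz' ⊢
      exact ⟨x, hz', hz⟩
    · intro hz
      refine Finset.card_lt_card ⟨fun z' hz' => ?_, fun hsub => ?_⟩
      · simp only [Finset.mem_filter, Finset.mem_univ, true_and] at hz' ⊢
        obtain ⟨y, h1, h2⟩ := hz'
        rcases le_total x y with h | h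
        · exact absurd (endCut_before_mono h hz) h2
        · exact endCut_before_mono h h1
      · have := hsub (show z ∈ _ by simpa using hz)
        simp only [Finset.mem_filter, Finset.mem_univ, true_and] at this
        obtain ⟨y, h1, h2⟩ := this
        exact h2 h1
  · intro x
    refine (Finset.card_le_univ _).trans ?_
    simp [mul_comm]

open Classical in
/-- The number of ends of rank less than `m` of the segments in the group `g`. -/
noncomputable def endCount (ev : Fin n × Bool → ℕ) (g : Fin n → Prop) (m : ℕ) : ℕ :=
  (Finset.univ.filter fun z : Fin n × Bool => g z.1 ∧ ev z < m).card

theorem endCount_mono (ev : Fin n × Bool → ℕ) (g : Fin n → Prop) : Monotone (endCount ev g) := by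
  intro m m' h
  refine Finset.card_le_card fun z hz => ?_
  simp only [Finset.mem_filter, Finset.mem_univ, true_and] at hz ⊢
  exact ⟨hz.1, hz.2.trans_le h⟩

theorem endCount_zero (ev : Fin n × Bool → ℕ) (g : Fin n → Prop) : endCount ev g 0 = 0 := by
  simp [endCount]

open Classical in
theorem endCount_le (ev : Fin n × Bool → ℕ) (g : Fin n → Prop) (m : ℕ) :
    endCount ev g m ≤ 2 * (Finset.univ.filter g).card := by
  have : (Finset.univ.filter fun z : Fin n × Bool => g z.1 ∧ ev z < m) ⊆
      Finset.univ.filter g ×ˢ Finset.univ := by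
    intro z hz
    simp only [Finset.mem_filter, Finset.mem_univ, true_and, Finset.mem_product, and_true] at hz ⊢
    exact hz.1
  refine (Finset.card_le_card this).trans ?_
  simp [Finset.card_product, mul_comm]

-- A segment that still meets the line has not passed its right end. Strictness matters: it excludes
-- the full count, which would open one window too many.
open Classical in
theorem endCount_lt {ev : Fin n × Bool → ℕ} {g : Fin n → Prop} {m : ℕ} {a : Fin n} (ha : g a)
    (h : ¬ ev (a, true) < m) : endCount ev g m < 2 * (Finset.univ.filter g).card := by
  have : (Finset.univ.filter fun z : Fin n × Bool => g z.1 ∧ ev z < m) ⊂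
      Finset.univ.filter g ×ˢ Finset.univ := by
    refine ⟨fun z hz => ?_, fun hsub => ?_⟩
    · simp only [Finset.mem_filter, Finset.mem_univ, true_and, Finset.mem_product, and_true] at hz ⊢
      exact hz.1
    · have := hsub (show (a, true) ∈ _ by simpa using ha)
      simp only [Finset.mem_filter, Finset.mem_univ, true_and] at this
      exact h this.2
  refine (Finset.card_lt_card this).trans_le ?_
  simp [Finset.card_product, mul_comm]

/-- Coordinates of a cut, as a disk word. -/
def Cut.Storable (T : Fin n → Seg) (κ : Cut) : Prop :=
  κ.word = .int 0 ∨ ∃ x, κ.word = .real x ∧ IsInputCoord T x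

theorem Seg.norm_coord (T : Fin n → Seg) (a : Fin n) :
    IsInputCoord T (T a).norm.p.1 ∧ IsInputCoord T (T a).norm.p.2 ∧
      IsInputCoord T (T a).norm.q.1 ∧ IsInputCoord T (T a).norm.q.2 := by
  unfold Seg.norm IsInputCoord
  split_ifs
  · exact ⟨⟨a, by simp⟩, ⟨a, by simp⟩, ⟨a, by simp⟩, ⟨a, by simp⟩⟩
  · exact ⟨⟨a, by simp⟩, ⟨a, by simp⟩, ⟨a, by simp⟩, ⟨a, by simp⟩⟩

theorem endCut_storable (T : Fin n → Seg) (z : Fin n × Bool) : (endCut T z).Storable T := by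
  unfold endCut
  obtain ⟨h1, -, h3, -⟩ := Seg.norm_coord T z.1
  split_ifs
  · exact Or.inr ⟨_, rfl, h3⟩
  · exact Or.inr ⟨_, rfl, h1⟩

variable {T : Fin n → Seg} {ev : Fin n × Bool → ℕ} {ρ : ℝ → ℕ}

/-- The cut where the number of ends in a group reaches `j`. -/
theorem IsRanking.exists_cut (hR : IsRanking T ev ρ) (g : Fin n → Prop) (j : ℕ) :
    ∃ κ : Cut, κ.Storable T ∧ ∀ x, κ.Before x ↔ j ≤ endCount ev g (ρ x) := by
  classical
  by_cases hj : j = 0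
  · exact ⟨.always, Or.inl rfl, fun x => by simp [Cut.Before, hj]⟩
  by_cases hex : ∃ m, j ≤ endCount ev g m
  · have hpos : Nat.find hex ≠ 0 := by
      intro h0
      have := Nat.find_spec hex
      rw [h0, endCount_zero] at this
      omega
    obtain ⟨m, hm⟩ := Nat.exists_eq_succ_of_ne_zero hpos
    have h1 : j ≤ endCount ev g (m + 1) := by
      have := Nat.find_spec hex
      rwa [hm] at this
    have h2 : ¬ j ≤ endCount ev g m := Nat.find_min hex (by omega)
    -- The count first reaches `j` at rank bound `m + 1`, so some end of the group has rank exactly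
    -- `m`; its cut is the right one, even if ties make the count jump past `j`.
    obtain ⟨z, hz, hz'⟩ := Finset.exists_mem_notMem_of_card_lt_card
      (show endCount ev g m < endCount ev g (m + 1) by omega)
    simp only [Finset.mem_filter, Finset.mem_univ, true_and, not_and] at hz hz'
    have hev : ev z = m := by
      have := hz' hz.1
      omega
    refine ⟨endCut T z, endCut_storable T z, fun x => ?_⟩
    rw [← hR.1, hev]
    constructor
    · intro h
      exact h1.trans (endCount_mono ev g h)
    · intro h
      by_contra hlt
      exact h2 (h.trans (endCount_mono ev g (not_lt.1 hlt)))
  · refine ⟨.never, Or.inl rfl, fun x => ?_⟩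
    simp only [Cut.Before, false_iff]
    exact fun h => hex ⟨_, h⟩

theorem IsRanking.meets_iff (hR : IsRanking T ev ρ) (a : Fin n) (x : ℝ) :
    (∃ y, (x, y) ∈ (T a).carrier) ↔ ev (a, false) < ρ x ∧ ¬ ev (a, true) < ρ x := by
  rw [Seg.exists_mem_iff, hR.1, hR.1]
  simp [endCut, Cut.Before]

/-- The sets of ends passed at two lines are nested, so equal counts mean equal sets. -/
theorem IsRanking.meets_congr (hR : IsRanking T ev ρ) {g : Fin n → Prop} {x x' : ℝ}
    (h : endCount ev g (ρ x) = endCount ev g (ρ x')) {a : Fin n} (ha : g a) :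
    (∃ y, (x, y) ∈ (T a).carrier) ↔ ∃ y, (x', y) ∈ (T a).carrier := by
  classical
  have main : ∀ m m', m ≤ m' → endCount ev g m = endCount ev g m' →
      ∀ z : Fin n × Bool, g z.1 → (ev z < m ↔ ev z < m') := by
    intro m m' hle he z hz
    refine ⟨fun h => h.trans_le hle, fun h => ?_⟩
    have hsub : (Finset.univ.filter fun z : Fin n × Bool => g z.1 ∧ ev z < m) ⊆
        Finset.univ.filter fun z : Fin n × Bool => g z.1 ∧ ev z < m' := by
      intro z hz
      simp only [Finset.mem_filter, Finset.mem_univ, true_and] at hz ⊢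
      exact ⟨hz.1, hz.2.trans_le hle⟩
    have := Finset.eq_of_subset_of_card_le hsub (le_of_eq he.symm)
    have hz' : z ∈ Finset.univ.filter fun z : Fin n × Bool => g z.1 ∧ ev z < m' := by
      simpa using ⟨hz, h⟩
    rw [← this] at hz'
    exact (by simpa using hz' : g z.1 ∧ ev z < m).2
  have all : ∀ z : Fin n × Bool, g z.1 → (ev z < ρ x ↔ ev z < ρ x') := by
    intro z hz
    rcases le_total (ρ x) (ρ x') with hle | hle
    · exact main _ _ hle h z hz
    · exact (main _ _ hle h.symm z hz).symm
  rw [hR.meets_iff, hR.meets_iff, all _ ha, all _ ha]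

/-! ### Entries and pages -/

/-- The words of an entry may be stored. -/
def Rec.Storable (T : Fin n → Seg) (rc : Rec) : Prop :=
  rc.lo.Storable T ∧ rc.hi.Storable T ∧
    ∀ s ∈ rc.seg, IsInputCoord T s.p.1 ∧ IsInputCoord T s.p.2 ∧ IsInputCoord T s.q.1 ∧
      IsInputCoord T s.q.2

theorem Cut.Storable.word {κ : Cut} (h : κ.Storable T) (W : ℕ) : StorableWord T W κ.word := by
  rcases h with h | ⟨x, h, hx⟩
  · rw [h]
    simp [StorableWord]
  · rw [h]
    exact hx

theorem storableWord_natCast {W k : ℕ} (h : k ≤ W) : StorableWord T W (.int (k : ℤ)) := by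
  simp only [StorableWord, Nat.abs_cast]
  exact_mod_cast h

theorem Rec.Storable.field {rc : Rec} (h : rc.Storable T) {W : ℕ} (hW : 3 ≤ W) (hp : rc.ptr ≤ W)
    (f : ℕ) : StorableWord T W (rc.field f) := by
  have h0 : StorableWord T W (.int 0) := by simp [StorableWord]
  have hk : ∀ κ : Cut, StorableWord T W (.int κ.kind) := by
    intro κ
    refine storableWord_natCast (le_trans ?_ hW)
    cases κ <;> simp [Cut.kind]
  rcases hs : rc.seg with _ | s
  · match f with
    | 0 => exact hk _
    | 1 => exact h.1.word W
    | 2 => exact hk _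
    | 3 => exact h.2.1.word W
    | 4 | 5 | 6 | 7 | 8 => simpa [Rec.field, hs] using h0
    | 9 => exact storableWord_natCast hp
    | f + 10 => exact h0
  · obtain ⟨h1, h2, h3, h4⟩ := h.2.2 s hs
    match f with
    | 0 => exact hk _
    | 1 => exact h.1.word W
    | 2 => exact hk _
    | 3 => exact h.2.1.word W
    | 4 =>
      simp only [Rec.field, hs, Option.elim]
      exact storableWord_natCast (k := 1) (by omega)
    | 5 => simpa [Rec.field, hs, StorableWord] using h1
    | 6 => simpa [Rec.field, hs, StorableWord] using h2
    | 7 => simpa [Rec.field, hs, StorableWord] using h3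
    | 8 => simpa [Rec.field, hs, StorableWord] using h4
    | 9 => exact storableWord_natCast hp
    | f + 10 => exact h0

/-- The entry for the queries between the ends `j` and `j + 1` of the group `g` that hit a segment
of `g`. -/
theorem IsRanking.exists_hit_entry (hR : IsRanking T ev ρ) (hT : Descending T) (g : Fin n → Prop)
    (j P : ℕ) : ∃ rc : Rec, rc.Storable T ∧ rc.ptr = P ∧
      ∀ q, rc.Valid q ↔ endCount ev g (ρ q.1) = j ∧ ∃ a, g a ∧ (T a).Hit q := by
  classical
  have hmeets : ∀ {a : Fin n} {q : Point}, (T a).Hit q → ∃ y, (q.1, y) ∈ (T a).carrier :=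
    fun ⟨y, _, h⟩ => ⟨y, h⟩
  by_cases hex : ∃ x₀, endCount ev g (ρ x₀) = j ∧ ∃ a, g a ∧ ∃ y, (x₀, y) ∈ (T a).carrier
  · obtain ⟨x₀, hx₀, a₀, ha₀⟩ := hex
    -- On all lines with count `j` the same segments of `g` are met. The smallest index `τ` among
    -- them is the topmost, so the ray hits some segment of `g` exactly if it hits `τ`.
    obtain ⟨τ, hτ, hmin⟩ := (Finset.univ.filter fun a => g a ∧
      ∃ y, (x₀, y) ∈ (T a).carrier).exists_minimal ⟨a₀, by simpa using ha₀⟩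
    obtain ⟨κ, hκ, hκ'⟩ := hR.exists_cut g j
    obtain ⟨κ₁, hκ₁, hκ₁'⟩ := hR.exists_cut g (j + 1)
    simp only [Finset.mem_filter, Finset.mem_univ, true_and] at hτ hmin
    refine ⟨⟨κ, κ₁, some (T τ).norm, P⟩, ⟨hκ, hκ₁, ?_⟩, rfl, fun q => ?_⟩
    · rintro s hs
      obtain rfl : (T τ).norm = s := by simpa using hs
      exact Seg.norm_coord T τ
    · simp only [Rec.Valid, hκ', hκ₁', Option.mem_def, Option.some.injEq, forall_eq']
      constructor
      · rintro ⟨h1, h2, h3⟩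
        have hj : endCount ev g (ρ q.1) = j := by omega
        refine ⟨hj, τ, hτ.1, ?_⟩
        exact (Seg.hit_iff _ _ ((hR.meets_congr (hx₀.trans hj.symm) hτ.1).1 hτ.2)).2 h3
      · rintro ⟨hj, a, hga, y, hy, hm⟩
        refine ⟨by omega, by omega, ?_⟩
        have hmτ := (hR.meets_congr (hx₀.trans hj.symm) hτ.1).1 hτ.2
        have hma := (hR.meets_congr (hx₀.trans hj.symm) hga).2 ⟨y, hm⟩
        rw [← Seg.hit_iff _ _ hmτ]
        obtain ⟨y', hm'⟩ := hmτ
        rcases le_total a τ with hle | hle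
        · obtain rfl : a = τ := le_antisymm hle (hmin ⟨hga, hma⟩ hle)
          exact ⟨y, hy, hm⟩
        · rcases hle.eq_or_lt with rfl | hlt
          · exact ⟨y, hy, hm⟩
          · exact ⟨y', hy.trans (hT _ _ hlt _ _ _ hm' hm), hm'⟩
  · refine ⟨⟨.never, .never, none, P⟩, ⟨Or.inl rfl, Or.inl rfl, by simp⟩, rfl, fun q => ?_⟩
    simp only [Rec.Valid, Cut.Before, false_and, false_iff]
    rintro ⟨hj, a, hga, ha⟩
    exact hex ⟨q.1, hj, a, hga, hmeets ha⟩

/-- The entry for the queries between the ends `j` and `j'` of the group `g`. -/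
theorem IsRanking.exists_range_entry (hR : IsRanking T ev ρ) (g : Fin n → Prop) (j j' P : ℕ) :
    ∃ rc : Rec, rc.Storable T ∧ rc.ptr = P ∧
      ∀ q, rc.Valid q ↔ j ≤ endCount ev g (ρ q.1) ∧ endCount ev g (ρ q.1) < j' := by
  obtain ⟨κ, hκ, hκ'⟩ := hR.exists_cut g j
  obtain ⟨κ₁, hκ₁, hκ₁'⟩ := hR.exists_cut g j'
  refine ⟨⟨κ, κ₁, none, P⟩, ⟨hκ, hκ₁, by simp⟩, rfl, fun q => ?_⟩
  simp [Rec.Valid, hκ', hκ₁']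

/-! ### Windows of counts and the `r`-ary tree over the list positions. -/

theorem exists_window (f : ℕ → ℕ) (N i : ℕ) {w : ℕ} (hw : 0 < w) :
    ∃ m₀ m₁, m₀ ≤ m₁ ∧ (∀ m ≤ N, f m / w = i → m₀ ≤ m ∧ m ≤ m₁) ∧ f m₁ < f m₀ + w := by
  classical
  by_cases hne : ((Finset.range (N + 1)).filter fun m => f m / w = i).Nonempty
  · set F := (Finset.range (N + 1)).filter fun m => f m / w = i
    refine ⟨F.min' hne, F.max' hne, F.min'_le _ (F.max'_mem hne), fun m hm hi => ?_, ?_⟩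
    · have : m ∈ F := by
        simp only [F, Finset.mem_filter, Finset.mem_range]
        exact ⟨by omega, hi⟩
      exact ⟨F.min'_le _ this, F.le_max' _ this⟩
    · have h0 := (Finset.mem_filter.1 (F.min'_mem hne)).2
      have h1 := (Finset.mem_filter.1 (F.max'_mem hne)).2
      rw [Nat.div_eq_iff hw] at h0 h1
      omega
  · refine ⟨0, 0, le_rfl, fun m hm hi => ?_, by omega⟩
    exact absurd ⟨m, by simpa using ⟨by omega, hi⟩⟩ hne

/-- The node with number `v` on level `k` of the `r`-ary tree over the positions. -/
def node (n r k v : ℕ) (a : Fin n) : Prop := (a : ℕ) / r ^ k = v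

/-- The children partition the node. This additivity bounds the number of entries of a page. -/
theorem endCount_node (ev : Fin n × Bool → ℕ) {r : ℕ} (hr : 0 < r) (k v m : ℕ) :
    endCount ev (node n r (k + 1) v) m =
      ∑ c ∈ Finset.Ico (v * r) (v * r + r), endCount ev (node n r k c) m := by
  classical
  have hdiv : ∀ a : ℕ, a / r ^ (k + 1) = v ↔ v * r ≤ a / r ^ k ∧ a / r ^ k < v * r + r := by
    intro a
    rw [pow_succ, ← Nat.div_div_eq_div_mul, Nat.div_eq_iff hr]
    constructor <;> intro h <;> omega
  unfold endCount
  rw [Finset.card_eq_sum_card_fiberwise (f := fun z : Fin n × Bool => (z.1 : ℕ) / r ^ k)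
    (t := Finset.Ico (v * r) (v * r + r))]
  · refine Finset.sum_congr rfl fun c hc => ?_
    refine congrArg Finset.card (Finset.ext fun z => ?_)
    rw [Finset.mem_Ico] at hc
    simp only [Finset.mem_filter, Finset.mem_univ, true_and]
    simp only [node, hdiv]
    constructor
    · rintro ⟨⟨-, h⟩, h'⟩
      exact ⟨h', h⟩
    · rintro ⟨rfl, h⟩
      exact ⟨⟨hc, h⟩, rfl⟩
  · intro z hz
    simp only [Finset.coe_filter, Set.mem_ofPred_eq, Finset.mem_univ, true_and, node, hdiv] at hz
    simpa using hz.1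

/-- The pages of the tree: the page for the window `i` of a node leads to the children of the node
in which the query hits a segment. -/
theorem IsRanking.exists_tree_page (hR : IsRanking T ev ρ) (hT : Descending T) {r : ℕ} (hr : 0 < r)
    (k v i : ℕ) (tgt : ℕ → ℕ → ℕ) : ∃ recs : List Rec, recs.length ≤ 3 * r ∧
      (∀ rc ∈ recs, rc.Storable T ∧ ∃ c j, rc.ptr = tgt c j) ∧
      ∀ q,
        (∀ rc ∈ recs, rc.Valid q → ∃ a : Fin n, (T a).Hit q ∧
          rc.ptr = tgt (a / r ^ k) (endCount ev (node n r k (a / r ^ k)) (ρ q.1))) ∧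
        ∀ a : Fin n, (T a).Hit q → a / r ^ (k + 1) = v →
          endCount ev (node n r (k + 1) v) (ρ q.1) / (2 * r) = i → ∃ rc ∈ recs, rc.Valid q ∧
            rc.ptr = tgt (a / r ^ k) (endCount ev (node n r k (a / r ^ k)) (ρ q.1)) := by
  classical
  choose rec hst hptr hval using fun c j =>
    hR.exists_hit_entry hT (node n r k c) j (tgt c j)
  obtain ⟨m₀, m₁, hle, hwin, hlt⟩ := exists_window
    (fun m => endCount ev (node n r (k + 1) v) m) (2 * n) i (w := 2 * r) (by omega)
  -- One entry for each child and each value between its counts at the two ends of the window. The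
  -- count of the node grows by less than `2 * r`, hence so do the counts of the children in total;
  -- one more value per child gives at most `3 * r` entries.
  let pairs := (Finset.Ico (v * r) (v * r + r)).sigma fun c =>
    Finset.Icc (endCount ev (node n r k c) m₀) (endCount ev (node n r k c) m₁)
  refine ⟨pairs.toList.map fun z => rec z.1 z.2, ?_, ?_, fun q => ⟨?_, ?_⟩⟩
  · rw [List.length_map, Finset.length_toList, Finset.card_sigma]
    simp only [Nat.card_Icc]
    have : ∀ c ∈ Finset.Ico (v * r) (v * r + r), endCount ev (node n r k c) m₁ + 1 -
        endCount ev (node n r k c) m₀ =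
        (endCount ev (node n r k c) m₁ - endCount ev (node n r k c) m₀) + 1 := by
      intro c _
      have := endCount_mono ev (node n r k c) hle
      omega
    rw [Finset.sum_congr rfl this, Finset.sum_add_distrib, Finset.sum_tsub_distrib _
      (fun c _ => endCount_mono ev (node n r k c) hle), ← endCount_node ev hr,
      ← endCount_node ev hr]
    simp only [Finset.sum_const, Nat.card_Ico, smul_eq_mul]
    omega
  · intro rc hrc
    obtain ⟨z, -, rfl⟩ := List.mem_map.1 hrc
    exact ⟨hst _ _, _, _, hptr _ _⟩
  · intro rc hrc hv
    obtain ⟨z, -, rfl⟩ := List.mem_map.1 hrc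
    obtain ⟨hj, a, ha, hhit⟩ := (hval _ _ q).1 hv
    refine ⟨a, hhit, ?_⟩
    rw [hptr]
    rw [node] at ha
    rw [ha, hj]
  · intro a hhit hav hi
    set c := (a : ℕ) / r ^ k with hc
    refine ⟨rec c (endCount ev (node n r k c) (ρ q.1)), List.mem_map.2
      ⟨⟨c, endCount ev (node n r k c) (ρ q.1)⟩, ?_, rfl⟩, ?_, hptr _ _⟩
    · rw [Finset.mem_toList, Finset.mem_sigma, Finset.mem_Ico, Finset.mem_Icc]
      obtain ⟨h1, h2⟩ := hwin _ (hR.2 q.1) hi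
      refine ⟨?_, endCount_mono _ _ h1, endCount_mono _ _ h2⟩
      rw [pow_succ, ← Nat.div_div_eq_div_mul, Nat.div_eq_iff hr] at hav
      dsimp only
      omega
    · exact (hval _ _ q).2 ⟨rfl, a, hc.symm, hhit⟩

/-- The pages of the search structure over the windows of a group. -/
theorem IsRanking.exists_search_page (hR : IsRanking T ev ρ) {r : ℕ} (hr : 0 < r)
    (g : Fin n → Prop) (j u : ℕ) (tgt : ℕ → ℕ) : ∃ recs : List Rec, recs.length ≤ 3 * r ∧
      (∀ rc ∈ recs, rc.Storable T ∧ ∃ c, rc.ptr = tgt c) ∧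
      ∀ q, endCount ev g (ρ q.1) / (2 * r) / r ^ (j + 1) = u →
        IsBest recs q (tgt (endCount ev g (ρ q.1) / (2 * r) / r ^ j)) := by
  have hrj : 0 < r ^ j := pow_pos hr j
  choose rec hst hptr hval using fun c => hR.exists_range_entry g (c * r ^ j * (2 * r))
    ((c + 1) * r ^ j * (2 * r)) (tgt c)
  -- The ranges are disjoint, so only one entry of the page can be valid for a query.
  have hval' : ∀ c q, (rec c).Valid q ↔ endCount ev g (ρ q.1) / (2 * r) / r ^ j = c := by
    intro c q
    rw [hval, Nat.div_eq_iff hrj, ← Nat.le_div_iff_mul_le (by omega),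
      ← Nat.div_lt_iff_lt_mul (by omega), Nat.add_mul]
    omega
  refine ⟨(List.range' (u * r) r).map rec, by simp; omega, ?_, fun q hu => ⟨Or.inr ?_, ?_⟩⟩
  · intro rc hrc
    obtain ⟨c, -, rfl⟩ := List.mem_map.1 hrc
    exact ⟨hst _, _, hptr _⟩
  · refine ⟨rec _, List.mem_map.2 ⟨_, ?_, rfl⟩, (hval' _ _).2 rfl, hptr _⟩
    rw [pow_succ, ← Nat.div_div_eq_div_mul, Nat.div_eq_iff hr] at hu
    rw [List.mem_range'_1]
    omega
  · intro rc hrc hv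
    obtain ⟨c, -, rfl⟩ := List.mem_map.1 hrc
    rw [hptr, (hval' _ _).1 hv]

end Ranks


/-! ### Layout of the disk -/

/-- The word at address `a` of a disk with a header of four words, `Q` pages with room for `R`
entries each, and a tail. -/
def layoutWord (hdr tail : ℕ → Word) (Q R : ℕ) (pages : ℕ → List Rec) (a : ℕ) : Word :=
  if a < 4 then hdr a
  else if a - 4 < Q * (1 + 10 * R) then
    if (a - 4) % (1 + 10 * R) = 0 then .int (pages ((a - 4) / (1 + 10 * R))).length
    else (pages ((a - 4) / (1 + 10 * R)))[((a - 4) % (1 + 10 * R) - 1) / 10]?.elim (.int 0)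
      fun rc => rc.field (((a - 4) % (1 + 10 * R) - 1) % 10)
  else tail (a - 4 - Q * (1 + 10 * R))

theorem exists_layout (hdr tail : ℕ → Word) (Q R m : ℕ) (pages : ℕ → List Rec)
    (hlen : ∀ P, (pages P).length ≤ R) : ∃ disk : List Word,
      disk.length = 4 + Q * (1 + 10 * R) + m ∧ (∀ i < 4, diskAt disk i = hdr i) ∧
      (∀ P < Q, PageAt disk (4 + P * (1 + 10 * R)) (pages P)) ∧
      (∀ i < m, diskAt disk (4 + Q * (1 + 10 * R) + i) = tail i) ∧
      ∀ w ∈ disk, (∃ i < 4, w = hdr i) ∨ (∃ i < m, w = tail i) ∨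
        (∃ k ≤ R, w = .int (k : ℕ)) ∨ ∃ P, ∃ rc ∈ pages P, ∃ f, w = rc.field f := by
  set Z := 1 + 10 * R with hZ
  have hat : ∀ a < 4 + Q * Z + m,
      diskAt ((List.range (4 + Q * Z + m)).map (layoutWord hdr tail Q R pages)) a =
        layoutWord hdr tail Q R pages a := by
    intro a ha
    simp [diskAt, ha]
  refine ⟨(List.range (4 + Q * Z + m)).map (layoutWord hdr tail Q R pages), by simp, ?_, ?_, ?_, ?_⟩
  · intro i hi
    rw [hat i (by omega), layoutWord, if_pos hi]
  · intro P hP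
    have hPZ : P * Z + Z ≤ Q * Z := by
      rw [← Nat.succ_mul]
      exact Nat.mul_le_mul_right _ hP
    have hoff : ∀ o < Z, 4 + P * Z + o < 4 + Q * Z + m ∧ (4 + P * Z + o - 4) / Z = P ∧
        (4 + P * Z + o - 4) % Z = o ∧ 4 + P * Z + o - 4 < Q * Z := by
      intro o ho
      have e : 4 + P * Z + o - 4 = o + P * Z := by omega
      refine ⟨by omega, ?_, ?_, by omega⟩
      · rw [e, Nat.add_mul_div_right _ _ (by omega), Nat.div_eq_of_lt ho, zero_add]
      · rw [e, Nat.add_mul_mod_self_right, Nat.mod_eq_of_lt ho]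
    constructor
    · obtain ⟨h1, h2, h3, h4⟩ := hoff 0 (by omega)
      rw [← Nat.add_zero (4 + P * Z), hat _ h1, layoutWord, if_neg (by omega), if_pos h4, ← hZ,
        if_pos h3, h2]
    · intro i hi f hf
      have := hlen P
      obtain ⟨h1, h2, h3, h4⟩ := hoff (1 + 10 * i + f) (by omega)
      have e : 4 + P * Z + 1 + 10 * i + f = 4 + P * Z + (1 + 10 * i + f) := by omega
      rw [e, hat _ h1, layoutWord, if_neg (by omega), if_pos h4, ← hZ, h2, h3, if_neg (by omega)]
      have e1 : (1 + 10 * i + f - 1) / 10 = i := by omega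
      have e2 : (1 + 10 * i + f - 1) % 10 = f := by omega
      rw [e1, e2, List.getElem?_eq_getElem hi]
      rfl
  · intro i hi
    rw [hat _ (by omega), layoutWord, ← hZ, if_neg (by omega), if_neg (by omega)]
    congr 1
    omega
  · intro w hw
    obtain ⟨a, ha, rfl⟩ := List.mem_map.1 hw
    rw [List.mem_range] at ha
    rw [layoutWord, ← hZ]
    split_ifs with h1 h2 h3
    · exact Or.inl ⟨a, h1, rfl⟩
    · exact Or.inr (Or.inr (Or.inl ⟨_, hlen _, rfl⟩))
    · rcases hget : (pages ((a - 4) / Z))[((a - 4) % Z - 1) / 10]? with _ | rc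
      · exact Or.inr (Or.inr (Or.inl ⟨0, Nat.zero_le _, rfl⟩))
      · exact Or.inr (Or.inr (Or.inr ⟨_, rc, List.mem_of_getElem? hget, _, rfl⟩))
    · exact Or.inr (Or.inl ⟨_, by omega, rfl⟩)

/-- A zero word at address `0` is an empty page leading back to itself. A query without hit idles
there, so all search paths can have the same length. -/
theorem walk_zero {B W : ℕ} {disk : List Word} {q : Point} (h : diskAt disk 0 = .int 0)
    (hW : 1 ≤ W) (d : ℕ) : Walk B W disk q d 0 0 := by
  induction d with
  | zero => exact .zero 0
  | succ d ih =>
    have hb : IsBest [] q 0 := ⟨Or.inl rfl, by simp⟩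
    exact .succ d 0 0 0 [] ⟨by simpa using h, by simp⟩ (by simp) (by simpa using hW) hb ih

-- The first bound limits the windows of a node, the second keeps the pages of the last node on a
-- level within the space reserved for the level.
open Classical in
theorem card_node_le {n r : ℕ} (hr : 0 < r) (k v : ℕ) :
    (Finset.univ.filter (node n r k v)).card ≤ r ^ k ∧
      (Finset.univ.filter (node n r k v)).card ≤ n - v * r ^ k := by
  have hrk : 0 < r ^ k := pow_pos hr k
  have h1 : (Finset.univ.filter (node n r k v)).image (fun a : Fin n => (a : ℕ)) ⊆
      Finset.Ico (v * r ^ k) (v * r ^ k + r ^ k) ∩ Finset.Ico (v * r ^ k) n := by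
    intro a ha
    simp only [Finset.mem_image, Finset.mem_filter, Finset.mem_univ, true_and, node] at ha
    obtain ⟨b, hb, rfl⟩ := ha
    rw [Nat.div_eq_iff hrk] at hb
    have := b.2
    rw [Finset.mem_inter, Finset.mem_Ico, Finset.mem_Ico]
    omega
  have h2 := Finset.card_le_card h1
  rw [Finset.card_image_of_injective _ Fin.val_injective] at h2
  constructor
  · refine h2.trans ((Finset.card_le_card Finset.inter_subset_left).trans ?_)
    simp
  · refine h2.trans ((Finset.card_le_card Finset.inter_subset_right).trans ?_)
    simp

/-- The data structure: a disk on which all queries follow a search path of length `2 * K` to the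
words `ans` and `face` of the code of their answer. -/
theorem exists_structure {n B W r K : ℕ} {T : Fin n → Seg} (hT : Descending T) (hn : 0 < n)
    (hr : 2 ≤ r) (hrB : r ≤ B) (hK : 0 < K) (hnK : n ≤ r ^ K)
    (hW : 4 + 2 * K * (n / r + 1) * (1 + 10 * (3 * r)) + 2 * n + 2 ≤ W) (ans face : ℕ → ℤ)
    (hans : ∀ m, m ≤ n → |ans m| ≤ (W : ℤ)) (hface : ∀ m, m ≤ n → |face m| ≤ (W : ℤ))
    (hans0 : ans 0 = 0) :
    ∃ disk : List Word,
      disk.length = 4 + 2 * K * (n / r + 1) * (1 + 10 * (3 * r)) + 2 * n ∧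
      (∀ w ∈ disk, StorableWord T W w) ∧ diskAt disk 2 = .int ((2 * K : ℕ) : ℤ) ∧
      ∃ A : ℕ, diskAt disk 3 = .int A ∧ ∀ q, ∃ L, L + 2 ≤ W ∧ Walk B W disk q (2 * K) A L ∧
        diskAt disk L = .int (ans (answerCode T q)) ∧
        diskAt disk (L + 1) = .int (face (answerCode T q)) := by
  have hr0 : 0 < r := by omega
  obtain ⟨ev, ρ, hR⟩ := exists_isRanking T
  set N := n / r + 1 with hN
  set Z := 1 + 10 * (3 * r) with hZ
  -- Level `l < K` holds at place `v * r ^ l + i` the page for window `i` of node `v` of height `l +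
  -- 1`. Levels `K` to `2 * K - 1` hold the search tree over the windows of the root.
  let pageAddr : ℕ → ℕ → ℕ := fun l p => 4 + (l * N + p) * Z
  let leafAddr : ℕ → ℕ := fun a => 4 + 2 * K * N * Z + 2 * a
  -- Entries that no search path uses may have targets outside the disk; a target too large for a
  -- word is replaced by `0`.
  let clip : ℕ → ℕ := fun P => if P ≤ W then P else 0
  have hclip : ∀ P, clip P ≤ P := fun P => by simp only [clip]; split_ifs <;> omega
  have hclipW : ∀ P, clip P ≤ W := fun P => by simp only [clip]; split_ifs <;> omega
  let tgt : ℕ → ℕ → ℕ → ℕ := fun k c j =>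
    if k = 0 then leafAddr c else pageAddr (k - 1) (c * r ^ (k - 1) + j / (2 * r))
  choose tp htpl htps htp using fun k v i =>
    hR.exists_tree_page hT hr0 k v i fun c j => clip (tgt k c j)
  choose sp hspl hsps hsp using fun j u =>
    hR.exists_search_page hr0 (node n r K 0) j u fun c => clip (pageAddr (K + j - 1) c)
  let page : ℕ → ℕ → List Rec := fun l p =>
    if l < K then tp l (p / r ^ l) (p % r ^ l) else sp (l - K) p
  have hpage : ∀ l p, (page l p).length ≤ 3 * r := fun l p => by
    simp only [page]
    split_ifs
    · exact htpl _ _ _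
    · exact hspl _ _
  let hdr : ℕ → Word := fun i => if i = 0 then .int (ans 0) else if i = 1 then .int (face 0) else
    if i = 2 then .int ((2 * K : ℕ) : ℤ) else .int (pageAddr (K - 1 + K) 0 : ℕ)
  let tail : ℕ → Word := fun i => if i % 2 = 0 then .int (ans (i / 2 + 1)) else
    .int (face (i / 2 + 1))
  obtain ⟨disk, hlen, hhdr, hpages, htail, hmem⟩ := exists_layout hdr tail (2 * K * N) (3 * r)
    (2 * n) (fun P => page (P / N) (P % N)) (fun P => hpage _ _)
  simp only [← hZ] at hlen hpages htail
  have hNpos : 0 < N := Nat.succ_pos _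
  have haddr : ∀ l p, l < 2 * K → p < N → pageAddr l p + Z ≤ 4 + 2 * K * N * Z := by
    intro l p hl hp
    have : (l * N + p + 1) * Z ≤ 2 * K * N * Z := by
      refine Nat.mul_le_mul_right _ ?_
      calc l * N + p + 1 ≤ l * N + N := by omega
        _ = (l + 1) * N := by ring
        _ ≤ 2 * K * N := Nat.mul_le_mul_right _ hl
    simp only [pageAddr]
    rw [Nat.add_mul _ 1] at this
    omega
  have hclipeq : ∀ P, P ≤ W → clip P = P := fun P hP => if_pos hP
  have hat : ∀ l p, l < 2 * K → p < N → PageAt disk (pageAddr l p) (page l p) := by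
    intro l p hl hp
    have hlt : l * N + p < 2 * K * N := by
      calc l * N + p < l * N + N := by omega
        _ = (l + 1) * N := by ring
        _ ≤ 2 * K * N := Nat.mul_le_mul_right _ hl
    have := hpages (l * N + p) hlt
    have e1 : (l * N + p) / N = l := by
      rw [Nat.add_comm, Nat.add_mul_div_right _ _ hNpos, Nat.div_eq_of_lt hp, zero_add]
    have e2 : (l * N + p) % N = p := by
      rw [Nat.add_comm, Nat.add_mul_mod_self_right, Nat.mod_eq_of_lt hp]
    rwa [e1, e2] at this
  have hstep : ∀ {q d l p P L}, l < 2 * K → p < N → IsBest (page l p) q P →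
      Walk B W disk q d P L → Walk B W disk q (d + 1) (pageAddr l p) L := by
    intro q d l p P L hl hp hb hw
    have h1 := hpage l p
    have h2 := haddr l p hl hp
    exact .succ d _ P L _ (hat l p hl hp) (by omega) (by omega) hb hw
  have hd0 : diskAt disk 0 = .int 0 := by
    rw [hhdr 0 (by omega)]
    simp only [hdr, if_true, hans0]
  refine ⟨disk, hlen, ?_, ?_, pageAddr (K - 1 + K) 0, ?_, ?_⟩
  · intro w hw
    have hKW : 2 * K ≤ W := by
      have : 2 * K * 1 * 1 ≤ 2 * K * N * Z :=
        Nat.mul_le_mul (Nat.mul_le_mul_left _ hNpos) (by omega)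
      omega
    have hZW : 1 * Z ≤ 2 * K * N * Z :=
      Nat.mul_le_mul_right _ (Nat.mul_pos (by omega) hNpos)
    have ha := haddr (K - 1 + K) 0 (by omega) hNpos
    rcases hmem w hw with ⟨i, hi, rfl⟩ | ⟨i, hi, rfl⟩ | ⟨k, hk, rfl⟩ | ⟨P, rc, hrc, f, rfl⟩
    · simp only [hdr]
      split_ifs
      · exact hans 0 (by omega)
      · exact hface 0 (by omega)
      · exact storableWord_natCast hKW
      · exact storableWord_natCast (by omega)
    · simp only [tail]
      split_ifs
      · exact hans _ (by omega)
      · exact hface _ (by omega)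
    · exact storableWord_natCast (by omega)
    · simp only [page] at hrc
      split_ifs at hrc
      · obtain ⟨h1, c, j, h2⟩ := htps _ _ _ rc hrc
        exact h1.field (by omega) (h2 ▸ hclipW _) f
      · obtain ⟨h1, c, h2⟩ := hsps _ _ rc hrc
        exact h1.field (by omega) (h2 ▸ hclipW _) f
  · rw [hhdr 2 (by omega)]
    simp [hdr]
  · rw [hhdr 3 (by omega)]
    simp [hdr]
  intro q
  set cnt : ℕ → ℕ → ℕ := fun k v => endCount ev (node n r k v) (ρ q.1) with hcnt
  have hroot : cnt K 0 / (2 * r) < N := by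
    have h1 : cnt K 0 ≤ 2 * n := by
      classical
      refine (endCount_le ev _ _).trans ?_
      have := (card_node_le (n := n) hr0 K 0).2
      omega
    rw [hN, Nat.lt_succ_iff, ← Nat.mul_div_mul_left n r (show 0 < 2 by omega)]
    exact Nat.div_le_div_right h1
  -- The path is built from its end. After `K` levels upwards the window number is divided by `r ^
  -- K`, which leaves the single page `0`.
  have hsearch : ∀ {d L}, Walk B W disk q d (pageAddr (K - 1) (cnt K 0 / (2 * r))) L →
      ∀ j ≤ K, Walk B W disk q (j + d) (pageAddr (K - 1 + j) (cnt K 0 / (2 * r) / r ^ j)) L := by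
    intro d L hw j
    induction j with
    | zero => simpa using hw
    | succ j ih =>
      intro hj
      have hlt : ∀ j, cnt K 0 / (2 * r) / r ^ j < N := fun j => (Nat.div_le_self _ _).trans_lt hroot
      have hb := hsp j _ q rfl
      have ha : pageAddr (K - 1 + j) (endCount ev (node n r K 0) (ρ q.1) / (2 * r) / r ^ j) + Z ≤
        4 + 2 * K * N * Z := haddr (K - 1 + j) _ (by omega) (hlt j)
      have e : K + j - 1 = K - 1 + j := by omega
      rw [e, hclipeq _ (by omega)] at hb
      have e2 : j + 1 + d = (j + d) + 1 := by omega
      rw [e2]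
      refine hstep (by omega) (hlt (j + 1)) ?_ (ih (by omega))
      simp only [page]
      rw [if_neg (by omega)]
      have e3 : K - 1 + (j + 1) - K = j := by omega
      rw [e3]
      exact hb
  have hstart : ∀ {L}, Walk B W disk q K (pageAddr (K - 1) (cnt K 0 / (2 * r))) L →
      Walk B W disk q (2 * K) (pageAddr (K - 1 + K) 0) L := by
    intro L hw
    have := hsearch hw K le_rfl
    have h0 : cnt K 0 / (2 * r) / r ^ K = 0 := by
      refine Nat.div_eq_of_lt ?_
      have : n / r < n := Nat.div_lt_self hn (by omega)
      omega
    rw [h0] at this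
    rwa [two_mul]
  rcases answerCode_cases T q with hcode | ⟨a, hcode⟩
  · refine ⟨0, by omega, hstart ?_, ?_, ?_⟩
    · rw [answerCode_eq_zero_iff] at hcode
      suffices h : Walk B W disk q (K - 1 + 1) (pageAddr (K - 1) (cnt K 0 / (2 * r))) 0 by
        rwa [show K - 1 + 1 = K by omega] at h
      -- A valid entry would witness a hit segment, so the page of the root has none and the path
      -- goes to address `0`, where words `0` and `1` are the answers for code `0`.
      refine hstep (by omega) hroot ⟨Or.inl rfl, fun rc hrc hv => ?_⟩ (walk_zero hd0 (by omega) _)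
      simp only [page] at hrc
      rw [if_pos (by omega)] at hrc
      obtain ⟨b, hb, -⟩ := (htp _ _ _ q).1 rc hrc hv
      exact absurd hb (hcode b)
    · rw [hcode, hans0, hd0]
    · rw [hcode, hhdr 1 (by omega)]
      simp [hdr]
  · obtain ⟨hhit, hmax⟩ := answerCode_eq_succ_iff.1 hcode
    have ha := a.2
    have hL1 : diskAt disk (leafAddr a) = .int (ans (a + 1)) := by
      rw [htail (2 * a) (by omega)]
      simp only [tail]
      rw [if_pos (by omega)]
      congr 3
      omega
    have hL2 : diskAt disk (leafAddr a + 1) = .int (face (a + 1)) := by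
      rw [show leafAddr a + 1 = 4 + 2 * K * N * Z + (2 * a + 1) by simp only [leafAddr]; omega,
        htail (2 * a + 1) (by omega)]
      simp only [tail]
      rw [if_neg (by omega)]
      congr 3
      omega
    refine ⟨leafAddr a, by simp only [leafAddr]; omega, hstart ?_, hcode ▸ hL1, hcode ▸ hL2⟩
    -- A node containing a hit has a count below twice its size. With size at most `r ^ (k + 1)` and
    -- windows of length `2 * r`, the window number is below `r ^ k`; with size at most `n - v * r ^
    -- (k + 1)` for node number `v`, the place is below `N`.
    have hwin : ∀ b : Fin n, (T b).Hit q → ∀ k,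
        cnt (k + 1) (b / r ^ (k + 1)) / (2 * r) < r ^ k ∧
          b / r ^ (k + 1) * r ^ k + cnt (k + 1) (b / r ^ (k + 1)) / (2 * r) < N := by
      rintro b ⟨y, -, hy⟩ k
      classical
      have h1 : cnt (k + 1) (b / r ^ (k + 1)) <
          2 * (Finset.univ.filter (node n r (k + 1) (b / r ^ (k + 1)))).card :=
        endCount_lt rfl ((hR.meets_iff b q.1).1 ⟨y, hy⟩).2
      obtain ⟨h2, h3⟩ := card_node_le (n := n) hr0 (k + 1) (b / r ^ (k + 1))
      have h4 : b / r ^ (k + 1) * r ^ (k + 1) ≤ b := Nat.div_mul_le_self _ _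
      have hb := b.2
      constructor
      · rw [Nat.div_lt_iff_lt_mul (by omega)]
        have : r ^ k * (2 * r) = 2 * r ^ (k + 1) := by ring
        omega
      · rw [hN, Nat.lt_succ_iff, ← Nat.mul_div_mul_left n r (show 0 < 2 by omega),
          Nat.le_div_iff_mul_le (by omega), Nat.add_mul]
        have h5 : b / r ^ (k + 1) * r ^ k * (2 * r) = 2 * (b / r ^ (k + 1) * r ^ (k + 1)) := by ring
        have h6 := Nat.div_mul_le_self (cnt (k + 1) (b / r ^ (k + 1))) (2 * r)
        omega
    -- Each valid entry leads to the child of some hit segment `b`. So if targets are monotone in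
    -- hit segments, the largest pointer is that of the last hit `a`; clipping can only lower the
    -- others.
    have hbest : ∀ k < K, tgt k (a / r ^ k) (cnt k (a / r ^ k)) ≤ W →
        (∀ b : Fin n, (T b).Hit q → tgt k (b / r ^ k) (cnt k (b / r ^ k)) ≤
          tgt k (a / r ^ k) (cnt k (a / r ^ k))) →
        IsBest (page k (a / r ^ (k + 1) * r ^ k + cnt (k + 1) (a / r ^ (k + 1)) / (2 * r))) q
          (tgt k (a / r ^ k) (cnt k (a / r ^ k))) := by
      intro k hk hle hmono
      have hw := (hwin a hhit k).1
      have hrk : 0 < r ^ k := pow_pos hr0 k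
      simp only [page]
      rw [if_pos hk, Nat.add_comm, Nat.add_mul_div_right _ _ hrk, Nat.add_mul_mod_self_right,
        Nat.div_eq_of_lt hw, Nat.mod_eq_of_lt hw, zero_add]
      obtain ⟨h1, h2⟩ := htp k (a / r ^ (k + 1)) (cnt (k + 1) (a / r ^ (k + 1)) / (2 * r)) q
      refine ⟨Or.inr ?_, fun rc hrc hv => ?_⟩
      · obtain ⟨rc, hrc, hv, hp⟩ := h2 a hhit rfl rfl
        exact ⟨rc, hrc, hv, hp.trans (hclipeq _ hle)⟩
      · obtain ⟨b, hb, hp⟩ := h1 rc hrc hv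
        rw [hp]
        exact (hclip _).trans (hmono b hb)
    have key : ∀ k < K, Walk B W disk q (k + 1) (pageAddr k (a / r ^ (k + 1) * r ^ k +
        cnt (k + 1) (a / r ^ (k + 1)) / (2 * r))) (leafAddr a) := by
      intro k
      induction k with
      | zero =>
        intro hk
        have ht : ∀ b j, tgt 0 (b / r ^ 0) j = leafAddr b := fun b j => by simp [tgt]
        refine hstep (by omega) (hwin a hhit 0).2 (hbest 0 hk ?_ ?_) ?_
        · rw [ht]
          simp only [leafAddr]
          omega
        · intro b hb
          have := Fin.le_def.1 (hmax b hb)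
          rw [ht, ht]
          simp only [leafAddr]
          omega
        · rw [ht]
          exact .zero _
      | succ k ih =>
        intro hk
        have ht : ∀ c j, tgt (k + 1) c j = pageAddr k (c * r ^ k + j / (2 * r)) := fun c j => by
          simp [tgt]
        refine hstep (by omega) (hwin a hhit (k + 1)).2 (hbest (k + 1) hk ?_ ?_) ?_
        · rw [ht]
          have := haddr k _ (by omega) (hwin a hhit k).2
          omega
        · intro b hb
          rw [ht, ht]
          have hab : (b : ℕ) / r ^ (k + 1) ≤ a / r ^ (k + 1) :=
            Nat.div_le_div_right (Fin.le_def.1 (hmax b hb))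
          have hwb := (hwin b hb k).1
          -- Equal nodes give the same page. A node with a smaller number stays within its own `r ^
          -- k` places, all before those of the node of `a`.
          have hp : b / r ^ (k + 1) * r ^ k + cnt (k + 1) (b / r ^ (k + 1)) / (2 * r) ≤
              a / r ^ (k + 1) * r ^ k + cnt (k + 1) (a / r ^ (k + 1)) / (2 * r) := by
            rcases hab.eq_or_lt with he | hlt
            · rw [he]
            · have h1 : (b / r ^ (k + 1) + 1) * r ^ k ≤ a / r ^ (k + 1) * r ^ k :=
                Nat.mul_le_mul_right _ hlt
              rw [Nat.succ_mul] at h1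
              exact le_trans (by omega) (Nat.le_add_right _ _)
          simp only [pageAddr]
          gcongr
        · rw [ht]
          exact ih (by omega)
    have h0 : (a : ℕ) / r ^ K = 0 := Nat.div_eq_of_lt (by omega)
    have := key (K - 1) (by omega)
    rw [show K - 1 + 1 = K by omega, h0, zero_mul, zero_add] at this
    exact this


/-! ### Renumbering and parameters -/

section Renumber

variable {n : ℕ} {S : Fin n → Seg} (e : Fin n ≃ Fin n)

theorem NonIntersecting.comp_equiv (hS : NonIntersecting S) :
    NonIntersecting fun a => S (e a) :=
  fun _ _ hij z hi hj => hS _ _ (e.injective.ne hij) z hi hj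

theorem freeSpace_comp_equiv : freeSpace (fun a => S (e a)) = freeSpace S := by
  unfold freeSpace
  rw [e.surjective.iUnion_comp fun i => (S i).carrier]

theorem faceOf_comp_equiv : faceOf (fun a => S (e a)) = faceOf S := by
  funext q
  rw [faceOf, faceOf, freeSpace_comp_equiv]

theorem faces_comp_equiv : faces (fun a => S (e a)) = faces S := by
  rw [faces, faces, freeSpace_comp_equiv, faceOf_comp_equiv]

theorem StorableWord.of_comp_equiv {W : ℕ} {w : Word}
    (h : StorableWord (fun a => S (e a)) W w) : StorableWord S W w := by
  cases w with
  | int k => exact h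
  | real x =>
    obtain ⟨i, hi⟩ := h
    exact ⟨e i, hi⟩

theorem IsSuccessor.of_comp_equiv {q : Point} {a : Fin n}
    (h : IsSuccessor (fun a => S (e a)) q a) : IsSuccessor S q (e a) := by
  obtain ⟨y, hy, hmin⟩ := h
  refine ⟨y, hy, fun j y' hj => hmin (e.symm j) y' ?_⟩
  simpa [HitsAt] using hj

end Renumber

/-- The arity of the search tree. -/
def arity (B n : ℕ) : ℕ := max 2 (min B n)

/-- The height of the search tree. -/
def height (B n : ℕ) : ℕ := Nat.clog (arity B n) n + 1

theorem le_arity_pow_height (B n : ℕ) : n ≤ arity B n ^ height B n :=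
  (Nat.le_pow_clog (lt_of_lt_of_le Nat.one_lt_two (le_max_left _ _)) n).trans
    (Nat.pow_le_pow_right (lt_of_lt_of_le Nat.two_pos (le_max_left _ _)) (Nat.le_succ _))

theorem height_le (B n : ℕ) : height B n ≤ n + 1 := by
  refine Nat.succ_le_succ (Nat.clog_le_of_le_pow ?_)
  exact (Nat.lt_pow_self (lt_of_lt_of_le Nat.one_lt_two (le_max_left _ _))).le

/-- For `n < B` the arity is at least `n`, so one level suffices and the height is at most `2`. -/
theorem height_le_logb {B n : ℕ} (hB : 2 ≤ B) (hn : 0 < n) :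
    (height B n : ℝ) ≤ 2 + Real.logb B n := by
  have hl : 0 ≤ Real.logb B n :=
    Real.logb_nonneg (by exact_mod_cast hB) (by exact_mod_cast hn)
  rcases le_or_gt B n with h | h
  · have : arity B n = B := by rw [arity, min_eq_left h, max_eq_right hB]
    rw [height, this, ← Real.natCeil_logb_natCast]
    have := Nat.ceil_lt_add_one hl
    push_cast
    linarith
  · have : Nat.clog (arity B n) n ≤ 1 := by
      refine Nat.clog_le_of_le_pow ?_
      rw [arity, min_eq_right h.le, pow_one]
      exact le_max_right _ _
    have : (height B n : ℝ) ≤ 2 := by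
      exact_mod_cast Nat.succ_le_succ this
    linarith

/-- The cap `min B n` in the arity gives `r ≤ 2 * n`, so even a single page takes `O(n)` words for
huge `B`. The constant is `31 + 62`. -/
theorem page_space_le {B n : ℕ} (hn : 0 < n) :
    (n / arity B n + 1) * (1 + 10 * (3 * arity B n)) ≤ 93 * n := by
  have h1 : 2 ≤ arity B n := le_max_left _ _
  have h2 : arity B n ≤ 2 * n := by
    rw [arity]
    exact max_le (by omega) ((min_le_right _ _).trans (by omega))
  generalize arity B n = r at *
  have h3 := Nat.div_mul_le_self n r
  calc (n / r + 1) * (1 + 10 * (3 * r)) ≤ (n / r + 1) * (31 * r) :=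
        Nat.mul_le_mul_left _ (by omega)
    _ = 31 * (n / r * r) + 31 * r := by ring
    _ ≤ 93 * n := by omega

/-- The number of words of the data structure. -/
def space (B n : ℕ) : ℕ :=
  4 + 2 * height B n * (n / arity B n + 1) * (1 + 10 * (3 * arity B n)) + 2 * n

theorem space_le {B n : ℕ} (hn : 0 < n) : space B n ≤ 6 * n + 186 * (height B n * n) := by
  have h := Nat.mul_le_mul_left (2 * height B n) (page_space_le (B := B) hn)
  rw [← Nat.mul_assoc] at h
  have e : 2 * height B n * (93 * n) = 186 * (height B n * n) := by ring
  rw [space]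
  omega

theorem two_mul_le_pow {X c : ℕ} (hX : 2 ≤ X) (hc : 6 ≤ c) : 2 * X ≤ X ^ c :=
  calc 2 * X ≤ X * X := Nat.mul_le_mul_right _ hX
    _ = X ^ 2 := by ring
    _ ≤ X ^ c := Nat.pow_le_pow_right (by omega) (by omega)

/-- As `5 ≤ X`, the numerical constants are absorbed by `X ^ 4`, which explains the exponent `6`. -/
theorem space_add_two_le {B n c : ℕ} (hn : 0 < n) (hB : 2 ≤ B) (hc : 6 ≤ c) :
    space B n + 2 ≤ (n + B + 2) ^ c := by
  set X := n + B + 2 with hX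
  have h1 := space_le (B := B) hn
  have h2 : height B n * n ≤ X * X := Nat.mul_le_mul ((height_le B n).trans (by omega)) (by omega)
  have h3 : X * 1 ≤ X * X := Nat.mul_le_mul_left _ (by omega)
  have h4 : 5 ^ 4 ≤ X ^ 4 := Nat.pow_le_pow_left (by omega) 4
  calc space B n + 2 ≤ 5 ^ 4 * (X * X) := by omega
    _ ≤ X ^ 4 * (X * X) := Nat.mul_le_mul_right _ h4
    _ = X ^ 6 := by ring
    _ ≤ X ^ c := Nat.pow_le_pow_right (by omega) hc

end ExtMem

/-! ### Assembly of the data structure and the query. -/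

theorem mainTheorem6 :
    ∃ (query : ExtMem.Cmd) (c : ℕ),
      ∀ (B M n : ℕ), 2 ≤ B → 2 * B ≤ M →
      ∀ S : Fin n → ExtMem.Seg, ExtMem.NonIntersecting S →
      ∃ (disk : List ExtMem.Word) (faceId : Set ExtMem.Point → ℤ),
        (∀ w ∈ disk, ExtMem.StorableWord S ((n + B + 2) ^ c) w) ∧
        (disk.length : ℝ) ≤ c * (n * (1 + Real.logb B n)) ∧
        Set.InjOn faceId (ExtMem.faces S) ∧
        ∀ q : ExtMem.Point, ∃ (t : ℕ) (s : ExtMem.State),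
          ExtMem.Exec B M ((n + B + 2) ^ c) disk query (ExtMem.queryState B n q) t s ∧
          (t : ℝ) ≤ c * (1 + Real.logb B n) ∧
          ExtMem.IsRayShootingAnswer S q (s.reg 0) ∧
          (q ∈ ExtMem.freeSpace S → s.reg 1 = .int (faceId (ExtMem.faceOf S q))) := by
  open ExtMem in
  -- Any `c` of at least `378` would do: the space is at most `378 * n + 186 * n * Real.logb B n`,
  -- the cost at most `129 + 62 * Real.logb B n`, and word sizes need only `6`.
  refine ⟨queryCmd, 1000, fun B M n hB hM S hS => ?_⟩
  obtain ⟨e, hT⟩ := hS.exists_descending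
  have hS' := hS.comp_equiv e
  obtain ⟨faceId, Φ, hinj, hid, hΦ⟩ := exists_faceId hS' hT
  rw [faces_comp_equiv] at hinj
  rw [freeSpace_comp_equiv, faceOf_comp_equiv] at hid
  have hX := two_mul_le_pow (X := n + B + 2) (c := 1000) (by omega) (by norm_num)
  have hspace := fun h => space_add_two_le (B := B) (n := n) (c := 1000) h hB (by norm_num)
  generalize (n + B + 2) ^ 1000 = W at *
  rcases Nat.eq_zero_or_pos n with rfl | hn
  -- On the empty disk all words read as `0`: path length `0`, answer `0`, and identifier `0`, which
  -- is the only value `Φ` can take for `n = 0`.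
  · refine ⟨[], faceId, by simp, by simp, hinj, fun q => ?_⟩
    obtain ⟨t, s, hex, ht, h0, h1⟩ := exec_query (B := B) (M := M) (disk := []) (n := 0) (q := q)
      (d := 0) (A := 0) (L := 0) (W := W) (by omega) (by omega) (by omega)
      rfl rfl (by omega) (by omega) (.zero 0)
    refine ⟨t, s, hex, ?_, Or.inr ⟨h0, fun i => i.elim0⟩, fun hq => ?_⟩
    · have : (t : ℝ) ≤ 5 := by exact_mod_cast ht
      simp
      linarith
    · have := hΦ (answerCode (fun a => S (e a)) q)
      rw [h1, hid q hq, show Φ _ = 0 by push_cast at this; omega]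
      rfl
  -- Code `a + 1` refers to position `a` in the descending list, which `e` translates back to the
  -- original number.
  · let ans : ℕ → ℤ := fun m =>
      if h : 0 < m ∧ m - 1 < n then ((e ⟨m - 1, h.2⟩ : Fin n) : ℤ) + 1 else 0
    have hl : 0 ≤ Real.logb B n :=
      Real.logb_nonneg (by exact_mod_cast hB) (by exact_mod_cast hn)
    have hKl := height_le_logb hB hn
    have hr : 2 ≤ arity B n := le_max_left _ _
    obtain ⟨disk, hlen, hst, hd2, A, hd3, hq⟩ := exists_structure (B := B) (r := arity B n)
      (K := height B n) (W := W) hT hn hr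
      (max_le hB (min_le_left _ _)) (Nat.succ_pos _) (le_arity_pow_height B n) (hspace hn)
      ans Φ (by
        intro m _
        simp only [ans]
        split_ifs with h
        · have := (e ⟨m - 1, h.2⟩).2
          rw [abs_le]
          omega
        · simp) (by
        intro m _
        have := hΦ m
        rw [abs_le]
        omega) rfl
    refine ⟨disk, faceId, fun w hw => (hst w hw).of_comp_equiv e, ?_, hinj, fun q => ?_⟩
    · have h1 : (disk.length : ℝ) ≤ 6 * n + 186 * (height B n * n) := by
        rw [hlen]
        exact_mod_cast space_le (B := B) hn
      have h2 : (height B n : ℝ) * n ≤ (2 + Real.logb B n) * n :=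
        mul_le_mul_of_nonneg_right hKl (Nat.cast_nonneg n)
      have h3 : 0 ≤ Real.logb B n * n := mul_nonneg hl (Nat.cast_nonneg n)
      have h4 : (0 : ℝ) ≤ n := Nat.cast_nonneg n
      push_cast
      linarith
    · obtain ⟨L, hL, hw, hL0, hL1⟩ := hq q
      obtain ⟨t, s, hex, ht, h0, h1⟩ := exec_query (M := M) (n := n) (by omega) (by omega)
        (by omega) hd2 hd3
        (by
          have := height_le B n
          omega) hL hw
      refine ⟨t, s, hex, ?_, ?_, fun hqf => ?_⟩
      · have : (t : ℝ) ≤ 31 * (2 * height B n) + 5 := by exact_mod_cast ht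
        push_cast
        linarith
      · rw [h0, hL0]
        rcases answerCode_cases (fun a => S (e a)) q with hc | ⟨a, hc⟩
        · refine Or.inr ⟨by rw [hc]; rfl, fun i y hi => ?_⟩
          refine answerCode_eq_zero_iff.1 hc (e.symm i) ⟨y, hi.1, ?_⟩
          simpa using hi.2
        · refine Or.inl ⟨e a, ?_, (hT.isSuccessor hc).of_comp_equiv e⟩
          rw [hc]
          simp only [ans]
          rw [dif_pos ⟨by omega, by have := a.2; omega⟩]
          rfl
      · rw [h1, hL1, hid q hqf]
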